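/- Let $c\ge 0$ be an integer and let $K$ be an oriented knot in $S^3$ given by a planar diagram with $c+2$ crossings, cut open at an arbitrary edge to a long knot diagram. For $n\ge 1$ let $J_K(n)\in\mathbb Z[q^{\pm1}]$ be the Jones polynomial of $K$ colored by the $n$-dimensional irreducible representation of $\mathfrak{sl}_2$, normalized to be $1$ for the unknot. Explicitly, put $v=q^{1/2}$, $\{m\}=v^m-v^{-m}$, $\{m\}!=\prod_{i=1}^m\{i\}$, $\{m\}_k=\prod_{i=0}^{k-1}\{m-i\}$, $\binom{m}{k}_v=\frac{\{m\}!}{\{k\}!\,\{m-k\}!}$ and $$R_+(n;a,b,k)=(-1)^k v^{-((n-1-2a)(n-1-2b)+k(k-1))/2}\binom{b+k}{k}_v\{n-1+k-a\}_k,$$ $$R_-(n;a,b,k)=v^{((n-1-2a-2k)(n-1-2b+2k)+k(k-1))/2}\binom{a+k}{k}_v\{n-1+k-b\}_k.$$ Draw the long knot diagram from bottom to top with both strands of every crossing oriented upwards, and let $\varphi_e$ be the number of counterclockwise full turns of the tangent along the edge $e$. Then $$J_K(n)=v^{w(n^2-1)/2}\sum_{\mathrm{col}}\ \prod_{x}R_x\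 \prod_e v^{\varphi_e(n-1-2\,\mathrm{col}(e))},$$ where $w$ is the writhe, the sum is over all colorings of the edges by $0,\dots,n-1$ in which both unbounded edges have color $0$ and at every crossing the color falls by some $k\ge 0$ along the over-strand and rises by the same $k$ along the under-strand, and $R_x$ is $R_+(n;a,b,k)$ at a positive and $R_-(n;a,b,k)$ at a negative crossing $x$, with $a$ and $b$ the colors of its lower left and lower right incoming edges. Then $$2\pi\,\limsup_{n\to\infty}\frac{\log|J_K(n)(e^{2\pi i/n})|}{n}\ \le\ v_8\,c ,$$ where $\log 0=-\infty$, $v_8=8\Lambda(\pi/4)$ is the volume of the regular ideal octahedron, and $\Lambda(z)=-\int_0^z\log|2\sin x|\,dx$ is the Lobachevsky function. -/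

import Mathlib

open scoped LaurentPolynomial

noncomputable section

namespace ColoredJones

/-! ### Quantum integers, factorials and binomials

All polynomials live in `ℤ[T;T⁻¹]`, where `T = v ^ (1/2) = q ^ (1/4)`; so `v = T²` and `q = T⁴`. -/

/-- `{m} = v ^ m - v ^ (-m)`, for an integer `m`. -/
def qInt (m : ℤ) : ℤ[T;T⁻¹] :=
  LaurentPolynomial.T (2 * m) - LaurentPolynomial.T (-(2 * m))

/-- `{m}! = {1}{2}⋯{m}`. -/
def qFactorial (m : ℕ) : ℤ[T;T⁻¹] :=
  ∏ i ∈ Finset.range m, qInt (i + 1)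

/-- `{m}_k = {m}{m-1}⋯{m-k+1}`, which is `{m}! / {m-k}!` for natural numbers `k ≤ m`. -/
def qFalling (m : ℤ) (k : ℕ) : ℤ[T;T⁻¹] :=
  ∏ i ∈ Finset.range k, qInt (m - i)

/-- The balanced quantum binomial coefficient `{m}! / ({k}! {m-k}!)` (and `0` for `k > m`), as a
Laurent polynomial; see `qBinomial_mul` for its characterization by quantum factorials. -/
def qBinomial : ℕ → ℕ → ℤ[T;T⁻¹]
  | _, 0 => 1
  | 0, _ + 1 => 0
  | m + 1, k + 1 =>
      LaurentPolynomial.T (2 * ((k : ℤ) + 1)) * qBinomial m (k + 1) +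
        LaurentPolynomial.T (-(2 * ((m : ℤ) - k))) * qBinomial m k

theorem qFactorial_succ (m : ℕ) : qFactorial (m + 1) = qFactorial m * qInt (m + 1) := by
  simp [qFactorial, Finset.prod_range_succ]

theorem qBinomial_eq_zero (m : ℕ) : ∀ k : ℕ, m < k → qBinomial m k = 0 := by
  induction m with
  | zero =>
    intro k hk
    obtain ⟨j, rfl⟩ := Nat.exists_eq_succ_of_ne_zero (by omega : k ≠ 0)
    simp [qBinomial]
  | succ m ih =>
    intro k hk
    obtain ⟨j, rfl⟩ := Nat.exists_eq_succ_of_ne_zero (by omega : k ≠ 0)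
    simp [qBinomial, ih (j + 1) (by omega), ih j (by omega)]

theorem qInt_add (a b : ℤ) :
    LaurentPolynomial.T (2 * b) * qInt a + LaurentPolynomial.T (-(2 * a)) * qInt b
      = qInt (a + b) := by
  simp only [qInt, mul_sub, ← LaurentPolynomial.T_add]
  ring_nf

/-- The quantum binomial coefficient is the quotient of quantum factorials. -/
theorem qBinomial_mul (j : ℕ) : ∀ k : ℕ,
    qBinomial (j + k) k * (qFactorial k * qFactorial j) = qFactorial (j + k) := by
  suffices h : ∀ m j k : ℕ, j + k = m →
      qBinomial m k * (qFactorial k * qFactorial j) = qFactorial m from fun k => h _ j k rfl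
  intro m
  induction m with
  | zero =>
    intro j k h
    obtain ⟨rfl, rfl⟩ : j = 0 ∧ k = 0 := by omega
    simp [qBinomial, qFactorial]
  | succ m ih =>
    intro j k h
    cases k with
    | zero =>
      obtain rfl : j = m + 1 := by omega
      simp [qBinomial, qFactorial]
    | succ k =>
      have h2 := ih j k (by omega)
      have hm : (m : ℤ) = j + k := by exact_mod_cast (by omega : m = j + k)
      have key := qInt_add (j : ℤ) ((k : ℤ) + 1)
      cases j with
      | zero =>
        have hz : qBinomial m (k + 1) = 0 := qBinomial_eq_zero m _ (by omega)
        have hm' : (m : ℤ) = k := by simpa using hm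
        have hmk : m = k := by omega
        subst hmk
        simp only [qBinomial, hz, sub_self]
        rw [qFactorial_succ]
        simp [qFactorial] at h2 ⊢
        rw [← mul_assoc, h2]
      | succ j =>
        have h1 := ih j (k + 1) (by omega)
        have hx : (m : ℤ) - k = ((j + 1 : ℕ) : ℤ) := by rw [hm]; ring
        simp only [qBinomial, hx]
        rw [qFactorial_succ m, show ((m : ℤ) + 1) = ((j + 1 : ℕ) : ℤ) + ((k : ℤ) + 1) by
          rw [hm]; ring, ← key]
        rw [qFactorial_succ k] at h1 ⊢
        rw [qFactorial_succ j] at h2 ⊢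
        push_cast at h1 h2 ⊢
        linear_combination
          (LaurentPolynomial.T (2 * ((k : ℤ) + 1)) * qInt ((j : ℤ) + 1)) * h1 +
          (LaurentPolynomial.T (-(2 * ((j : ℤ) + 1))) * qInt ((k : ℤ) + 1)) * h2

/-! ### The local weights -/

/-- The entries of the braiding: `e_a ⊗ e_b ↦ ∑_k Rplus n a b k • e_{b+k} ⊗ e_{a-k}`. -/
def Rplus (n a b k : ℕ) : ℤ[T;T⁻¹] :=
  (-1) ^ k *
    LaurentPolynomial.T (-(((n : ℤ) - 1 - 2 * a) * ((n : ℤ) - 1 - 2 * b) + (k : ℤ) * (k - 1))) *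
    qBinomial (b + k) k * qFalling ((n : ℤ) - 1 + k - a) k

/-- The entries of the inverse: `e_a ⊗ e_b ↦ ∑_k Rminus n a b k • e_{b-k} ⊗ e_{a+k}`. -/
def Rminus (n a b k : ℕ) : ℤ[T;T⁻¹] :=
  LaurentPolynomial.T
      (((n : ℤ) - 1 - 2 * a - 2 * k) * ((n : ℤ) - 1 - 2 * b + 2 * k) + (k : ℤ) * (k - 1)) *
    qBinomial (a + k) k * qFalling ((n : ℤ) - 1 + k - b) k

/-! ### Long knot diagrams -/

/-- A signed Gauss code with `N` crossings of an oriented long curve. Travelling along the curve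
one meets the `2N` passages `p : Fin (2N)` in order; the passages separate `2N + 1` edges, and
passage `p` leads from edge `p.castSucc` to edge `p.succ`. Each crossing consists of one
over-passage and one under-passage. -/
structure GaussCode (N : ℕ) where
  /-- the over-passage of a crossing -/
  overP : Fin N → Fin (2 * N)
  /-- the under-passage of a crossing -/
  underP : Fin N → Fin (2 * N)
  /-- every passage belongs to exactly one strand of one crossing -/
  bijective : Function.Bijective (Sum.elim overP underP)
  /-- `true` for a positive crossing, `false` for a negative one -/
  positive : Fin N → Bool

namespace GaussCode

variable {N : ℕ} (G : GaussCode N)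

/- Draw each crossing upright, that is, with both strands oriented upwards. In a positive crossing
the over-strand runs from the lower left to the upper right, in a negative crossing the
under-strand does. -/

/-- The passage that runs from the lower left to the upper right. -/
def rising (x : Fin N) : Fin (2 * N) := if G.positive x then G.overP x else G.underP x

/-- The passage that runs from the lower right to the upper left. -/
def falling (x : Fin N) : Fin (2 * N) := if G.positive x then G.underP x else G.overP x

/-- lower left (incoming) edge -/
def sw (x : Fin N) : Fin (2 * N + 1) := (G.rising x).castSucc

/-- upper right (outgoing) edge -/
def ne (x : Fin N) : Fin (2 * N + 1) := (G.rising x).succ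

/-- lower right (incoming) edge -/
def se (x : Fin N) : Fin (2 * N + 1) := (G.falling x).castSucc

/-- upper left (outgoing) edge -/
def nw (x : Fin N) : Fin (2 * N + 1) := (G.falling x).succ

end GaussCode

/-- The two sides of an edge, with respect to its orientation. -/
inductive Side
  | left
  | right
  deriving DecidableEq

instance : Fintype Side := ⟨{Side.left, Side.right}, fun s => by cases s <;> decide⟩

/-- Two sides of edges are adjacent if they meet in one of the four corners of a crossing; moreover
the left (right) sides of the two unbounded edges `0` and `2N` bound the same, left (right),
unbounded region. -/
inductive Corner {N : ℕ} (G : GaussCode N) :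
    Fin (2 * N + 1) × Side → Fin (2 * N + 1) × Side → Prop
  | west (x : Fin N) : Corner G (G.sw x, Side.left) (G.nw x, Side.left)
  | south (x : Fin N) : Corner G (G.se x, Side.left) (G.sw x, Side.right)
  | north (x : Fin N) : Corner G (G.nw x, Side.right) (G.ne x, Side.left)
  | east (x : Fin N) : Corner G (G.ne x, Side.right) (G.se x, Side.right)
  | outerLeft : Corner G (Fin.last (2 * N), Side.left) (0, Side.left)
  | outerRight : Corner G (Fin.last (2 * N), Side.right) (0, Side.right)

/-- The regions cut out by the curve on the surface determined by its Gauss code. -/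
def Face {N : ℕ} (G : GaussCode N) : Type := Quot (Corner G)

/-- The region on a side of an edge. -/
def face {N : ℕ} (G : GaussCode N) (s : Fin (2 * N + 1) × Side) : Face G := Quot.mk _ s

/-- The code is planar: the closed curve is a connected graph with `N` vertices and `2N` edges, so
by Euler's formula it is drawn on a sphere iff it has `N + 2` regions. -/
def Planar {N : ℕ} (G : GaussCode N) : Prop := Nat.card (Face G) = N + 2

open Classical in
/-- Twice the total turning (in full turns) of the tangent direction along the boundary of the
region `f`, traversed with `f` on the left, if edge `e` makes `rot e` full counterclockwise turns.
The tangent is vertical at the crossings; the boundary makes a half turn at each north or south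
corner, and does not turn at an east or west corner. -/
def turning {N : ℕ} (G : GaussCode N) (rot : Fin (2 * N + 1) → ℤ) (f : Face G) : ℤ :=
  2 * (∑ e, if face G (e, Side.left) = f then rot e else 0)
    - 2 * (∑ e, if face G (e, Side.right) = f then rot e else 0)
    + (∑ x, if face G (G.se x, Side.left) = f then 1 else 0)
    + (∑ x, if face G (G.nw x, Side.right) = f then 1 else 0)

/-- A diagram with `N` crossings, in the oriented plane, of an oriented long knot. It comes from
below, leaves upwards, and is drawn with all its crossings upright. A diagram of a knot in the
3-sphere is cut to such a diagram at an edge (moved next to infinity); every planar long diagram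
can be drawn in this way. -/
structure LongKnotDiagram (N : ℕ) extends GaussCode N where
  planar : Planar toGaussCode
  /-- the rotation number of an edge: the number of counterclockwise full turns of its tangent -/
  rot : Fin (2 * N + 1) → ℤ
  /-- the boundary of a bounded region makes one full turn -/
  turning_bounded : ∀ f : Face toGaussCode,
    f ≠ face toGaussCode (0, Side.left) → f ≠ face toGaussCode (0, Side.right) →
      turning toGaussCode rot f = 2
  /-- the boundary of the left unbounded region has total turning zero -/
  turning_left : turning toGaussCode rot (face toGaussCode (0, Side.left)) = 0
  /-- the boundary of the right unbounded region has total turning zero -/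
  turning_right : turning toGaussCode rot (face toGaussCode (0, Side.right)) = 0

namespace LongKnotDiagram

variable {N : ℕ} (D : LongKnotDiagram N)

/-- The local weight at a crossing of a coloring of the edges by `0, …, n - 1`: the color drops by
some `k ≥ 0` along the over-strand and rises by the same `k` along the under-strand (otherwise the
weight is zero). The over-strand comes in on the lower left at a positive crossing, and on the
lower right at a negative one. -/
def localWeight (n : ℕ) (col : Fin (2 * N + 1) → Fin n) (x : Fin N) : ℤ[T;T⁻¹] :=
  let oIn : ℕ := col (D.overP x).castSucc
  let oOut : ℕ := col (D.overP x).succ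
  let uIn : ℕ := col (D.underP x).castSucc
  let uOut : ℕ := col (D.underP x).succ
  if oOut ≤ oIn ∧ uOut = uIn + (oIn - oOut) then
    if D.positive x then Rplus n oIn uIn (oIn - oOut) else Rminus n uIn oIn (oIn - oOut)
  else 0

/-- The weight of a coloring: the product of the local weights at the crossings and of the factors
`v ^ (rot e * (n - 1 - 2 * col e))` at the edges, which come from the local extrema. -/
def weight (n : ℕ) (col : Fin (2 * N + 1) → Fin n) : ℤ[T;T⁻¹] :=
  (∏ x, D.localWeight n col x) *
    ∏ e, LaurentPolynomial.T (2 * (D.rot e * ((n : ℤ) - 1 - 2 * ((col e : ℕ) : ℤ))))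

/-- The writhe: the sum of the signs of the crossings. -/
def writhe : ℤ := ∑ x, if D.positive x then 1 else -1

/-- The `n`-th colored Jones polynomial (color: the `n`-dimensional representation of `sl₂`), in
`T = q ^ (1/4)`, normalized to be `1` for the unknot. It is the state sum over all colorings in
which the two unbounded edges have color `0`, with the framing corrected. -/
def coloredJones (n : ℕ) : ℤ[T;T⁻¹] :=
  LaurentPolynomial.T (D.writhe * ((n : ℤ) ^ 2 - 1)) *
    ∑ col : Fin (2 * N + 1) → Fin n,
      if (col 0 : ℕ) = 0 ∧ (col (Fin.last (2 * N)) : ℕ) = 0 then D.weight n col else 0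

end LongKnotDiagram

/-- Evaluation at `q = exp (2πi/n)`, that is, at `T = q ^ (1/4) = exp (2πi/(4n))`. -/
def ev (n : ℕ) : ℤ[T;T⁻¹] →+* ℂ :=
  LaurentPolynomial.eval₂ (Int.castRingHom ℂ)
    (Units.mk0 (Complex.exp (2 * Real.pi * Complex.I / (4 * n))) (Complex.exp_ne_zero _))

/-- The Lobachevsky function. -/
def lobachevsky (z : ℝ) : ℝ := -∫ x in (0 : ℝ)..z, Real.log |2 * Real.sin x|

/-- The volume of the regular ideal octahedron. -/
def v8 : ℝ := 8 * lobachevsky (Real.pi / 4)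

end ColoredJones

end

noncomputable section

namespace ColoredJones

open LaurentPolynomial (T)

/-! At `q = exp (2πi/n)` one has `|{n - m}| = |{m}|`, so a nonzero crossing weight has the modulus
of `{b+k}! {a}! / ({k}! {b}! {a-k}!)`. Its logarithm is a combination of Riemann sums of `log |2 sin
x|`, hence at most `n / π` times the maximum of the corresponding combination of integrals, up to
`O(log n)` (`logSineSum_le`). That maximum is `v8 / 2`, reached when `k` corresponds to `π / 2` and
both intervals of length `k` are centred in `[0, π]` (`growth_le`). Since there are only
polynomially many colorings, a diagram with `c + 2` crossings yields at once the bound `v8 * (c +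
2)`.

Two crossings are saved by a good choice of the edge where the knot is cut. Colors fall along
over-strands and rise along under-strands, so an extreme color `0` or `n - 1` on a suitable edge
forces `k = 0` at two crossings (`exists_two_flat`), and weights with `k = 0` have modulus one.

It remains to see that the cut may be moved and that the color `n - 1` is as good as `0`. The
crossing weights intertwine the coproduct `E ⊗ 1 + K ⊗ E` of the raising operator of quantum `sl₂`
(`crossingWeight_raising`). Insert `E` on the curve, with a tail of operators `K` that leads to the
unbounded region, and slide it once along the whole curve: the open state sum with color `a` on the
cut edge is `T (4 * a)` times the one with color `0` (`stateSum_eq`). The closed state sum is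
therefore, up to a unit, a quantum dimension times the open one. It does not change when an edge is
swept through infinity (`closedSum_pushAcross`), and the quantum dimension is a nonzero Laurent
polynomial that can be cancelled, so all cuts give the same value (`exists_stateSum_eq`).

No tail is ever drawn. Having `N + 2` regions means that every circulation on the edges is the
difference of a potential across the edges (`exists_potential`), and the exponent of the tail is
such a potential plus a framing term. The framing terms fit together at the crossings because the
turning conditions of the regions, paired with arbitrary functions on the regions, say exactly this
(`framing_defect`). -/

/-! ### Quantum integers, and the intertwining relation of the crossing weights. -/

theorem qInt_ne_zero {m : ℤ} (hm : m ≠ 0) : qInt m ≠ 0 := by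
  intro h
  have h3 := AddMonoidAlgebra.of_injective (R := ℤ) (M := ℤ) (a₁ := Multiplicative.ofAdd (2 * m)) (a₂ := Multiplicative.ofAdd (-(2 * m))) (sub_eq_zero.1 h)
  have := Multiplicative.ofAdd.injective h3
  omega

theorem qFalling_succ (m : ℤ) (k : ℕ) : qFalling m (k + 1) = qFalling m k * qInt (m - k) := by
  simp [qFalling, Finset.prod_range_succ]

theorem qFalling_succ' (m : ℤ) (k : ℕ) :
    qFalling m (k + 1) = qInt m * qFalling (m - 1) k := by
  simp only [qFalling, Finset.prod_range_succ', mul_comm (qInt m)]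
  congr 1
  · refine Finset.prod_congr rfl fun i _ => ?_
    congr 1
    push_cast
    ring
  · simp

theorem qFactorial_ne_zero (m : ℕ) : qFactorial m ≠ 0 :=
  Finset.prod_ne_zero_iff.2 fun i _ => qInt_ne_zero (by omega)

/-- `{k+1} * binom (j+k+1) (k+1) = {j+k+1} * binom (j+k) k`. -/
theorem qInt_mul_qBinomial_succ (j k : ℕ) :
    qInt (k + 1) * qBinomial (j + (k + 1)) (k + 1)
      = qInt (j + k + 1) * qBinomial (j + k) k := by
  have h1 := qBinomial_mul j (k + 1)
  have h2 := qBinomial_mul j k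
  rw [← Nat.add_assoc, qFactorial_succ, qFactorial_succ] at h1
  push_cast at h1
  rw [← Nat.add_assoc]
  refine mul_right_cancel₀ (mul_ne_zero (qFactorial_ne_zero k) (qFactorial_ne_zero j)) ?_
  linear_combination h1 - qInt (j + k + 1) * h2

/-- `{k+1} * binom (j+1+k) (k+1) = {j+1} * binom (j+1+k) k`. -/
theorem qInt_mul_qBinomial_shift (j k : ℕ) :
    qInt (k + 1) * qBinomial (j + (k + 1)) (k + 1)
      = qInt (j + 1) * qBinomial (j + 1 + k) k := by
  have h1 := qBinomial_mul j (k + 1)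
  have h2 := qBinomial_mul (j + 1) k
  rw [qFactorial_succ] at h1 h2
  rw [show j + (k + 1) = j + 1 + k by ring] at h1 ⊢
  refine mul_right_cancel₀ (mul_ne_zero (qFactorial_ne_zero k) (qFactorial_ne_zero j)) ?_
  linear_combination h1 - h2

theorem qBinomial_zero_right (m : ℕ) : qBinomial m 0 = 1 := by
  cases m <;> rfl

/-- The weight of a crossing with integer colors `a`, `b` on the lower left and lower right edge and
`x`, `y` on the upper left and upper right edge. -/
def crossingWeight (positive : Bool) (n : ℕ) (a b x y : ℤ) : ℤ[T;T⁻¹] :=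
  if a + b = x + y then
    if positive then
      if y ≤ a then Rplus n a.toNat b.toNat (a - y).toNat else 0
    else
      if x ≤ b then Rminus n a.toNat b.toNat (b - x).toNat else 0
  else 0

/-- The matrix entry of the raising operator `e_a ↦ {n - a} e_{a-1}`. -/
def raising (n : ℕ) (a : ℤ) : ℤ[T;T⁻¹] := if a = 0 then 0 else qInt (n - a)

theorem raising_zero (n : ℕ) : raising n 0 = 0 := if_pos rfl

theorem raising_succ (n b : ℕ) : raising n ((b + 1 : ℕ) : ℤ) = qInt (n - (b + 1)) := by
  rw [raising, if_neg (by omega)]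
  push_cast
  rfl

theorem qFalling_shift_left (m : ℤ) (k : ℕ) (f : ℤ) (h : f = m - k) :
    qInt f * qFalling m k = qFalling m (k + 1) := by
  rw [qFalling_succ, h, mul_comm]

theorem qFalling_shift_right (m : ℤ) (k : ℕ) (f : ℤ) (h : f = m + 1) :
    qInt f * qFalling m k = qFalling (m + 1) (k + 1) := by
  rw [qFalling_succ', h, add_sub_cancel_right]

/-- The intertwining relation of the positive crossing weights, in the generic case. -/
theorem Rplus_raising (n Y m b : ℕ) :
    qInt (n - (Y + m + 1)) * Rplus n (Y + m) b m
      + T (2 * ((n : ℤ) - 1 - 2 * (Y + m + 1))) *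
        (raising n b * Rplus n (Y + m + 1) (b - 1) (m + 1))
    = qInt (n - (b + m) - 1) * Rplus n (Y + m + 1) b (m + 1)
      + T (2 * ((n : ℤ) - 1 - 2 * (b + m))) * (qInt (n - Y - 1) * Rplus n (Y + m + 1) b m) := by
  -- After multiplication by `{m+1}` all four terms are multiples of `B * F`; the cofactors satisfy
  -- the identity `key` between quantum integers and powers of `T`.
  set F := qFalling ((n : ℤ) - 1 - Y) (m + 1) with hF
  set B := qBinomial (b + m) m with hB
  have r1 : qInt (n - (Y + m + 1)) * Rplus n (Y + m) b m
      = (-1) ^ m * T (-(((n : ℤ) - 1 - 2 * (Y + m)) * ((n : ℤ) - 1 - 2 * b) + m * (m - 1)))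
        * B * F := by
    rw [hF, ← qFalling_shift_left _ _ _ rfl, Rplus]
    push_cast
    rw [show (n : ℤ) - 1 + m - (Y + m) = n - 1 - Y by ring,
      show (n : ℤ) - (Y + m + 1) = n - 1 - Y - m by ring]
    ring
  have r4 : qInt (n - Y - 1) * Rplus n (Y + m + 1) b m
      = (-1) ^ m * T (-(((n : ℤ) - 1 - 2 * (Y + m + 1)) * ((n : ℤ) - 1 - 2 * b) + m * (m - 1)))
        * B * F := by
    rw [hF, show (n : ℤ) - 1 - Y = n - 1 - Y - 1 + 1 by ring,
      ← qFalling_shift_right _ _ _ rfl, Rplus]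
    push_cast
    rw [show (n : ℤ) - 1 + m - (Y + m + 1) = n - 1 - Y - 1 by ring,
      show (n : ℤ) - Y - 1 = n - 1 - Y - 1 + 1 by ring]
    ring
  have r3 : qInt (m + 1) * Rplus n (Y + m + 1) b (m + 1)
      = (-1) ^ (m + 1) *
        T (-(((n : ℤ) - 1 - 2 * (Y + m + 1)) * ((n : ℤ) - 1 - 2 * b) + (m + 1) * m))
        * (qInt (b + m + 1) * B) * F := by
    rw [hF, hB, ← qInt_mul_qBinomial_succ, Rplus]
    push_cast
    rw [show (n : ℤ) - 1 + (m + 1) - (Y + m + 1) = n - 1 - Y by ring, add_sub_cancel_right]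
    ring
  have r2 : qInt (m + 1) * (raising n b * Rplus n (Y + m + 1) (b - 1) (m + 1))
      = (-1) ^ (m + 1) *
        T (-(((n : ℤ) - 1 - 2 * (Y + m + 1)) * ((n : ℤ) - 1 - 2 * (b - 1)) + (m + 1) * m))
        * (qInt (n - b) * qInt b * B) * F := by
    -- For `b = 0` the truncated `b - 1` does no harm: `raising n 0` and `{0}` both vanish.
    rcases Nat.eq_zero_or_pos b with rfl | hb
    · simp [raising_zero, qInt]
    · obtain ⟨d, rfl⟩ := Nat.exists_eq_add_of_le' hb
      have := qInt_mul_qBinomial_shift d m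
      rw [raising_succ, Nat.add_sub_cancel, hF, hB, Rplus]
      push_cast
      rw [show (n : ℤ) - 1 + (m + 1) - (Y + m + 1) = n - 1 - Y by ring, add_sub_cancel_right,
        add_sub_cancel_right]
      linear_combination (-1) ^ (m + 1) *
        T (-(((n : ℤ) - 1 - 2 * (Y + m + 1)) * ((n : ℤ) - 1 - 2 * d) + (m + 1) * m)) *
        qInt (n - (d + 1)) * qFalling (n - 1 - Y) (m + 1) * this
  have key : qInt (m + 1) * T (-(((n : ℤ) - 1 - 2 * (Y + m)) * ((n : ℤ) - 1 - 2 * b) + m * (m - 1)))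
      - T (2 * ((n : ℤ) - 1 - 2 * (Y + m + 1))) *
        T (-(((n : ℤ) - 1 - 2 * (Y + m + 1)) * ((n : ℤ) - 1 - 2 * (b - 1)) + (m + 1) * m)) *
        (qInt (n - b) * qInt b)
      = - (qInt (n - (b + m) - 1) * qInt (b + m + 1) *
          T (-(((n : ℤ) - 1 - 2 * (Y + m + 1)) * ((n : ℤ) - 1 - 2 * b) + (m + 1) * m)))
        + qInt (m + 1) * (T (2 * ((n : ℤ) - 1 - 2 * (b + m))) *
          T (-(((n : ℤ) - 1 - 2 * (Y + m + 1)) * ((n : ℤ) - 1 - 2 * b) + m * (m - 1)))) := by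
    simp only [qInt, mul_sub, sub_mul, ← LaurentPolynomial.T_add]
    ring_nf
  refine mul_left_cancel₀ (qInt_ne_zero (m := m + 1) (by omega)) ?_
  rw [r1, r4]
  linear_combination T (2 * ((n : ℤ) - 1 - 2 * (Y + m + 1))) * r2 - qInt (n - (b + m) - 1) * r3
    + (-1) ^ m * B * F * key

/-- The intertwining relation of the negative crossing weights, in the generic case. -/
theorem Rminus_raising (n a X m : ℕ) :
    raising n a * Rminus n (a - 1) (X + m + 1) (m + 1)
      + T (2 * ((n : ℤ) - 1 - 2 * a)) * (qInt (n - (X + m + 1)) * Rminus n a (X + m) m)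
    = qInt (n - X - 1) * Rminus n a (X + m + 1) m
      + T (2 * ((n : ℤ) - 1 - 2 * X)) *
        (qInt (n - (a + m) - 1) * Rminus n a (X + m + 1) (m + 1)) := by
  set F := qFalling ((n : ℤ) - 1 - X) (m + 1) with hF
  set B := qBinomial (a + m) m with hB
  have r1 : qInt (n - (X + m + 1)) * Rminus n a (X + m) m
      = T (((n : ℤ) - 1 - 2 * a - 2 * m) * ((n : ℤ) - 1 - 2 * X) + m * (m - 1)) * B * F := by
    rw [hF, ← qFalling_shift_left _ _ _ rfl, Rminus]
    push_cast
    rw [show (n : ℤ) - 1 + m - (X + m) = n - 1 - X by ring,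
      show (n : ℤ) - (X + m + 1) = n - 1 - X - m by ring,
      show (n : ℤ) - 1 - 2 * (X + m) + 2 * m = n - 1 - 2 * X by ring]
    ring
  have r4 : qInt (n - X - 1) * Rminus n a (X + m + 1) m
      = T (((n : ℤ) - 1 - 2 * a - 2 * m) * ((n : ℤ) - 1 - 2 * (X + 1)) + m * (m - 1)) * B * F := by
    rw [hF, show (n : ℤ) - 1 - X = n - 1 - X - 1 + 1 by ring,
      ← qFalling_shift_right _ _ _ rfl, Rminus]
    push_cast
    rw [show (n : ℤ) - 1 + m - (X + m + 1) = n - 1 - X - 1 by ring,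
      show (n : ℤ) - X - 1 = n - 1 - X - 1 + 1 by ring,
      show (n : ℤ) - 1 - 2 * (X + m + 1) + 2 * m = n - 1 - 2 * (X + 1) by ring]
    ring
  have r3 : qInt (m + 1) * Rminus n a (X + m + 1) (m + 1)
      = T (((n : ℤ) - 1 - 2 * a - 2 * (m + 1)) * ((n : ℤ) - 1 - 2 * X) + (m + 1) * m)
        * (qInt (a + m + 1) * B) * F := by
    rw [hF, hB, ← qInt_mul_qBinomial_succ, Rminus]
    push_cast
    rw [show (n : ℤ) - 1 + (m + 1) - (X + m + 1) = n - 1 - X by ring, add_sub_cancel_right,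
      show (n : ℤ) - 1 - 2 * (X + m + 1) + 2 * (m + 1) = n - 1 - 2 * X by ring]
    ring
  have r2 : qInt (m + 1) * (raising n a * Rminus n (a - 1) (X + m + 1) (m + 1))
      = T (((n : ℤ) - 1 - 2 * a - 2 * m) * ((n : ℤ) - 1 - 2 * X) + (m + 1) * m)
        * (qInt (n - a) * qInt a * B) * F := by
    rcases Nat.eq_zero_or_pos a with rfl | ha
    · simp [raising_zero, qInt]
    · obtain ⟨d, rfl⟩ := Nat.exists_eq_add_of_le' ha
      have := qInt_mul_qBinomial_shift d m
      rw [raising_succ, Nat.add_sub_cancel, hF, hB, Rminus]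
      push_cast
      rw [show (n : ℤ) - 1 + (m + 1) - (X + m + 1) = n - 1 - X by ring, add_sub_cancel_right,
        show (n : ℤ) - 1 - 2 * (X + m + 1) + 2 * (m + 1) = n - 1 - 2 * X by ring,
        show (n : ℤ) - 1 - 2 * d - 2 * (m + 1) = n - 1 - 2 * (d + 1) - 2 * m by ring]
      linear_combination
        T (((n : ℤ) - 1 - 2 * (d + 1) - 2 * m) * ((n : ℤ) - 1 - 2 * X) + (m + 1) * m) *
        qInt (n - (d + 1)) * qFalling (n - 1 - X) (m + 1) * this
  have key : T (((n : ℤ) - 1 - 2 * a - 2 * m) * ((n : ℤ) - 1 - 2 * X) + (m + 1) * m)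
        * (qInt (n - a) * qInt a)
      + qInt (m + 1) * (T (2 * ((n : ℤ) - 1 - 2 * a)) *
        T (((n : ℤ) - 1 - 2 * a - 2 * m) * ((n : ℤ) - 1 - 2 * X) + m * (m - 1)))
      = qInt (m + 1) *
        T (((n : ℤ) - 1 - 2 * a - 2 * m) * ((n : ℤ) - 1 - 2 * (X + 1)) + m * (m - 1))
      + T (2 * ((n : ℤ) - 1 - 2 * X)) * (qInt (n - (a + m) - 1) * qInt (a + m + 1) *
        T (((n : ℤ) - 1 - 2 * a - 2 * (m + 1)) * ((n : ℤ) - 1 - 2 * X) + (m + 1) * m)) := by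
    simp only [qInt, mul_sub, sub_mul, mul_add, add_mul, ← LaurentPolynomial.T_add]
    ring_nf
  refine mul_left_cancel₀ (qInt_ne_zero (m := m + 1) (by omega)) ?_
  rw [r1, r4]
  linear_combination r2
    - T (2 * ((n : ℤ) - 1 - 2 * X)) * qInt (n - (a + m) - 1) * r3 + B * F * key

theorem crossingWeight_of_ne {p : Bool} {n : ℕ} {a b x y : ℤ} (h : a + b ≠ x + y) :
    crossingWeight p n a b x y = 0 := if_neg h

/-- The crossing weights commute with the raising operator. -/
theorem crossingWeight_raising (p : Bool) (n : ℕ) {a b x y : ℤ} (ha : 0 ≤ a) (hb : 0 ≤ b)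
    (hx : 0 ≤ x) (hy : 0 ≤ y) :
    raising n a * crossingWeight p n (a - 1) b x y
      + T (2 * ((n : ℤ) - 1 - 2 * a)) * (raising n b * crossingWeight p n a (b - 1) x y)
    = qInt (n - x - 1) * crossingWeight p n a b (x + 1) y
      + T (2 * ((n : ℤ) - 1 - 2 * x)) * (qInt (n - y - 1) * crossingWeight p n a b x (y + 1)) := by
  -- The operator lowers the total color by one; for any other total all four weights vanish.
  by_cases hs : a + b = x + y + 1
  swap
  · simp only [crossingWeight_of_ne (show a - 1 + b ≠ x + y by omega),
      crossingWeight_of_ne (show a + (b - 1) ≠ x + y by omega),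
      crossingWeight_of_ne (show a + b ≠ x + 1 + y by omega),
      crossingWeight_of_ne (show a + b ≠ x + (y + 1) by omega), mul_zero, add_zero]
  simp only [crossingWeight, if_pos (show a - 1 + b = x + y by omega),
    if_pos (show a + (b - 1) = x + y by omega),
    if_pos (show a + b = x + 1 + y by omega), if_pos (show a + b = x + (y + 1) by omega)]
  lift a to ℕ using ha
  lift b to ℕ using hb
  lift x to ℕ using hx
  lift y to ℕ using hy
  cases p
  · simp only [Bool.false_eq_true, if_false]
    rcases lt_trichotomy (b : ℤ) x with h | h | h
    · rw [if_neg (by omega), if_neg (by omega), if_neg (by omega), if_neg (by omega)]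
      simp
    -- The boundary case: only the two terms with `k = 0` survive.
    · rw [if_pos (by omega), if_neg (by omega), if_neg (by omega), if_pos (by omega)]
      obtain rfl : b = x := by omega
      obtain rfl : a = y + 1 := by omega
      rw [raising_succ]
      rw [show ((b : ℤ) - b).toNat = 0 by omega,
        show ((y + 1 : ℕ) - 1 : ℤ).toNat = y by omega, Int.toNat_natCast, Int.toNat_natCast]
      simp only [Rminus, qFalling, qBinomial_zero_right, Finset.range_zero, Finset.prod_empty]
      push_cast
      rw [show (n : ℤ) - y - 1 = n - (y + 1) by ring, mul_left_comm (T _) (qInt _), mul_zero]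
      simp only [mul_one, ← LaurentPolynomial.T_add]
      ring_nf
    · obtain ⟨m, rfl⟩ : ∃ m : ℕ, b = x + m + 1 := ⟨b - x - 1, by omega⟩
      obtain rfl : y = a + m := by omega
      rw [if_pos (by omega), if_pos (by omega), if_pos (by omega), if_pos (by omega)]
      rw [show ((a : ℤ) - 1).toNat = a - 1 by omega, show ((x + m + 1 : ℕ) : ℤ).toNat = x + m + 1 by omega,
        show ((x + m + 1 : ℕ) - (x : ℤ)).toNat = m + 1 by omega, Int.toNat_natCast,
        show ((x + m + 1 : ℕ) - 1 : ℤ).toNat = x + m by omega,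
        show ((x + m + 1 : ℕ) - 1 - (x : ℤ)).toNat = m by omega,
        show ((x + m + 1 : ℕ) - ((x : ℤ) + 1)).toNat = m by omega,
        show raising n ((x + m + 1 : ℕ) : ℤ) = qInt (n - (x + m + 1)) by
          rw [raising_succ]; push_cast; rfl]
      push_cast
      exact Rminus_raising n a x m
  · simp only [if_true]
    rcases lt_trichotomy (a : ℤ) y with h | h | h
    · rw [if_neg (by omega), if_neg (by omega), if_neg (by omega), if_neg (by omega)]
      simp
    · rw [if_neg (by omega), if_pos (by omega), if_pos (by omega), if_neg (by omega)]
      obtain rfl : a = y := by omega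
      obtain rfl : b = x + 1 := by omega
      rw [raising_succ]
      rw [show ((a : ℤ) - a).toNat = 0 by omega,
        show ((x + 1 : ℕ) - 1 : ℤ).toNat = x by omega, Int.toNat_natCast, Int.toNat_natCast]
      simp only [Rplus, qFalling, qBinomial_zero_right, Finset.range_zero, Finset.prod_empty]
      push_cast
      rw [show (n : ℤ) - x - 1 = n - (x + 1) by ring, mul_left_comm (T _) (qInt _), mul_zero]
      simp only [mul_one, one_mul, pow_zero, ← LaurentPolynomial.T_add]
      ring_nf
    · obtain ⟨m, rfl⟩ : ∃ m : ℕ, a = y + m + 1 := ⟨a - y - 1, by omega⟩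
      obtain rfl : x = b + m := by omega
      rw [if_pos (by omega), if_pos (by omega), if_pos (by omega), if_pos (by omega)]
      rw [show ((b : ℤ) - 1).toNat = b - 1 by omega, show ((y + m + 1 : ℕ) : ℤ).toNat = y + m + 1 by omega,
        show ((y + m + 1 : ℕ) - (y : ℤ)).toNat = m + 1 by omega, Int.toNat_natCast,
        show ((y + m + 1 : ℕ) - 1 : ℤ).toNat = y + m by omega,
        show ((y + m + 1 : ℕ) - 1 - (y : ℤ)).toNat = m by omega,
        show ((y + m + 1 : ℕ) - ((y : ℤ) + 1)).toNat = m by omega,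
        show raising n ((y + m + 1 : ℕ) : ℤ) = qInt (n - (y + m + 1)) by
          rw [raising_succ]; push_cast; rfl]
      push_cast
      exact Rplus_raising n y m b

/-! ### Combinatorics of Gauss codes and of closed diagrams. -/

namespace GaussCode

variable {N : ℕ} (G : GaussCode N)

theorem rising_injective : Function.Injective G.rising := by
  intro x y h
  have := G.bijective.1
  unfold rising at h
  split_ifs at h
  · exact Sum.inl_injective (this (a₁ := Sum.inl x) (a₂ := Sum.inl y) h)
  · simpa using this (a₁ := Sum.inl x) (a₂ := Sum.inr y) h
  · simpa using this (a₁ := Sum.inr x) (a₂ := Sum.inl y) h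
  · exact Sum.inr_injective (this (a₁ := Sum.inr x) (a₂ := Sum.inr y) h)

theorem falling_injective : Function.Injective G.falling := by
  intro x y h
  have := G.bijective.1
  unfold falling at h
  split_ifs at h
  · exact Sum.inr_injective (this (a₁ := Sum.inr x) (a₂ := Sum.inr y) h)
  · simpa using this (a₁ := Sum.inr x) (a₂ := Sum.inl y) h
  · simpa using this (a₁ := Sum.inl x) (a₂ := Sum.inr y) h
  · exact Sum.inl_injective (this (a₁ := Sum.inl x) (a₂ := Sum.inl y) h)

theorem rising_ne_falling (x y : Fin N) : G.rising x ≠ G.falling y := by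
  intro h
  have := G.bijective.1
  unfold rising falling at h
  by_cases hxy : x = y
  · subst hxy
    split_ifs at h
    · simpa using this (a₁ := Sum.inl x) (a₂ := Sum.inr x) h
    · simpa using this (a₁ := Sum.inr x) (a₂ := Sum.inl x) h
  · split_ifs at h
    · simpa using this (a₁ := Sum.inl x) (a₂ := Sum.inr y) h
    · exact hxy (Sum.inl_injective (this (a₁ := Sum.inl x) (a₂ := Sum.inl y) h))
    · exact hxy (Sum.inr_injective (this (a₁ := Sum.inr x) (a₂ := Sum.inr y) h))
    · simpa using this (a₁ := Sum.inr x) (a₂ := Sum.inl y) h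

theorem exists_rising_or_falling (p : Fin (2 * N)) :
    ∃ x, p = G.rising x ∨ p = G.falling x := by
  obtain ⟨z, rfl⟩ := G.bijective.2 p
  rcases z with x | x
  · refine ⟨x, ?_⟩
    unfold rising falling
    by_cases h : G.positive x <;> simp [h]
  · refine ⟨x, ?_⟩
    unfold rising falling
    by_cases h : G.positive x <;> simp [h]

theorem bijective_rising_falling : Function.Bijective (Sum.elim G.rising G.falling) := by
  constructor
  · rintro (x | x) (y | y) h
    · exact congrArg _ (G.rising_injective h)
    · exact absurd h (G.rising_ne_falling x y)
    · exact absurd h.symm (G.rising_ne_falling y x)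
    · exact congrArg _ (G.falling_injective h)
  · intro p
    obtain ⟨x, h | h⟩ := G.exists_rising_or_falling p
    · exact ⟨Sum.inl x, h.symm⟩
    · exact ⟨Sum.inr x, h.symm⟩

theorem sum_passages {A : Type*} [AddCommMonoid A] (f : Fin (2 * N) → A) :
    ∑ p, f p = ∑ x, (f (G.rising x) + f (G.falling x)) := by
  rw [Finset.sum_add_distrib, ← (Equiv.ofBijective _ G.bijective_rising_falling).sum_comp,
    Fintype.sum_sum_type]
  rfl

end GaussCode

/-- A planar diagram of a closed curve, with marked edge `0`: the passage `p` of the Gauss code leads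
from the edge `p` to the edge `p + 1`, and the two sides of the edges belong to the given
regions, which are those of a sphere. -/
structure ClosedDiagram (N : ℕ) [NeZero (2 * N)] extends GaussCode N where
  Region : Type
  [fintypeRegion : Fintype Region]
  [decEqRegion : DecidableEq Region]
  left : Fin (2 * N) → Region
  right : Fin (2 * N) → Region
  west : ∀ x, left (toGaussCode.rising x) = left (toGaussCode.falling x + 1)
  south : ∀ x, left (toGaussCode.falling x) = right (toGaussCode.rising x)
  north : ∀ x, right (toGaussCode.falling x + 1) = left (toGaussCode.rising x + 1)
  east : ∀ x, right (toGaussCode.rising x + 1) = right (toGaussCode.falling x)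
  cover : ∀ f, ∃ e, f = left e ∨ f = right e
  card_region : Fintype.card Region = N + 2

attribute [instance] ClosedDiagram.fintypeRegion ClosedDiagram.decEqRegion

/-- The indicator function of the edges after a passage. -/
def after {M : ℕ} (p i : Fin M) : ℤ := if p < i then 1 else 0

section after
variable {M : ℕ} [NeZero M]

theorem val_add_one_cases (q : Fin M) :
    (q + 1 = 0 ∧ (q : ℕ) + 1 = M) ∨ (q + 1 ≠ 0 ∧ ((q + 1 : Fin M) : ℕ) = q + 1) := by
  have hq := q.2
  rcases Nat.lt_or_ge ((q : ℕ) + 1) M with h | h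
  · right
    have h1 : ((q + 1 : Fin M) : ℕ) = q + 1 := Fin.val_add_one_of_lt' h
    refine ⟨fun h0 => ?_, h1⟩
    rw [h0] at h1
    simp at h1
  · left
    have h2 : (q : ℕ) + 1 = M := by omega
    refine ⟨?_, h2⟩
    apply Fin.ext
    rw [Fin.val_add, Fin.val_one', Nat.add_mod_mod, h2]
    simp

theorem after_zero (p : Fin M) : after p 0 = 0 := if_neg (by simp)

/-- The last term is the wrap-around: on arriving at the marked edge `0` the indicator drops back to
`0`. -/
theorem after_succ (p q : Fin M) :
    after p (q + 1) = after p q + (if p = q then 1 else 0) - (if q + 1 = 0 then 1 else 0) := by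
  have hp := p.2
  rcases val_add_one_cases q with ⟨h, h'⟩ | ⟨h, h'⟩
  · rw [h, after_zero, if_pos rfl]
    simp only [after, Fin.lt_def, Fin.ext_iff]
    split_ifs <;> omega
  · rw [if_neg h]
    simp only [after, Fin.lt_def, Fin.ext_iff, h']
    split_ifs <;> omega

/-- Induction along the edges. -/
theorem edge_induction {P : Fin M → Prop} (h0 : P 0) (hs : ∀ p : Fin M, P p → P (p + 1)) :
    ∀ e, P e := by
  have : ∀ j : ℕ, ∀ hj : j < M, P ⟨j, hj⟩ := by
    intro j
    induction j with
    | zero => intro hj; exact h0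
    | succ j ih =>
      intro hj
      have := hs _ (ih (by omega))
      rwa [show (⟨j, by omega⟩ : Fin M) + 1 = ⟨j + 1, hj⟩ from
        Fin.ext (Fin.val_add_one_of_lt' (by exact hj))] at this
  exact fun e => this e e.2

end after

/-! ### Circulations on the edges and their potentials on the regions. -/

namespace ClosedDiagram

variable {N : ℕ} [NeZero (2 * N)] (C : ClosedDiagram N)

/-- A function on the edges that is conserved at the crossings. -/
def IsCirculation {K : Type*} [Add K] (g : Fin (2 * N) → K) : Prop :=
  ∀ x, g (C.rising x + 1) + g (C.falling x + 1) = g (C.rising x) + g (C.falling x)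

/-- The change of a function along the rising strand of a crossing. -/
def jump {K : Type*} [Sub K] (g : Fin (2 * N) → K) (x : Fin N) : K :=
  g (C.rising x + 1) - g (C.rising x)

/-- The loop of a crossing: the difference of the indicator functions of the edges after the
rising and after the falling passage. -/
def loop (x : Fin N) (i : Fin (2 * N)) : ℤ := after (C.rising x) i - after (C.falling x) i

theorem loop_zero (x : Fin N) : C.loop x 0 = 0 := by simp [loop, after_zero]

theorem loop_succ (x : Fin N) (p : Fin (2 * N)) :
    C.loop x (p + 1) = C.loop x p + (if C.rising x = p then 1 else 0)
      - (if C.falling x = p then 1 else 0) := by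
  simp only [loop, after_succ]
  ring

theorem isCirculation_loop (x : Fin N) : C.IsCirculation (C.loop x) := by
  intro y
  simp only [loop_succ, C.rising_injective.eq_iff, C.falling_injective.eq_iff,
    C.rising_ne_falling, (C.rising_ne_falling _ _).symm, if_false]
  ring

/-- The loops are dual to the jumps, so that together with the constant `1` they form a basis of the
circulations. -/
theorem jump_loop (x y : Fin N) : C.jump (C.loop x) y = if x = y then 1 else 0 := by
  simp only [jump, loop_succ, C.rising_injective.eq_iff, (C.rising_ne_falling _ _).symm, if_false]
  ring

theorem sum_jump_loop {K : Type*} [CommRing K] {g : Fin (2 * N) → K} (hg : C.IsCirculation g)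
    (p : Fin (2 * N)) :
    ∑ x, C.jump g x * ((if C.rising x = p then 1 else 0) - (if C.falling x = p then 1 else 0))
      = g (p + 1) - g p := by
  obtain ⟨y, rfl | rfl⟩ := C.exists_rising_or_falling p
  · rw [Finset.sum_eq_single y]
    · rw [if_pos rfl, if_neg (fun h => C.rising_ne_falling _ _ h.symm), jump]
      ring
    · intro x _ hx
      rw [if_neg (fun h => hx (C.rising_injective h)),
        if_neg (fun h => C.rising_ne_falling _ _ h.symm)]
      ring
    · simp
  · rw [Finset.sum_eq_single y]
    · rw [if_pos rfl, if_neg (C.rising_ne_falling _ _), jump]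
      linear_combination - hg y
    · intro x _ hx
      rw [if_neg (fun h => hx (C.falling_injective h)), if_neg (C.rising_ne_falling _ _)]
      ring
    · simp

/-- A circulation is determined by its value at the edge `0` and its jumps. -/
theorem circulation_eq {K : Type*} [CommRing K] {g : Fin (2 * N) → K} (hg : C.IsCirculation g)
    (e : Fin (2 * N)) : g e = g 0 + ∑ x, C.jump g x * (C.loop x e : K) := by
  induction e using edge_induction with
  | h0 => simp [loop_zero]
  | hs p ih =>
    have := C.sum_jump_loop hg p
    have h2 : ∑ x, C.jump g x * (C.loop x (p + 1) : K) = ∑ x, C.jump g x * (C.loop x p : K) +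
        ∑ x, C.jump g x *
          ((if C.rising x = p then 1 else 0) - (if C.falling x = p then 1 else 0)) := by
      rw [← Finset.sum_add_distrib]
      refine Finset.sum_congr rfl fun x _ => ?_
      rw [loop_succ]
      push_cast
      ring
    rw [h2, this, ← add_assoc, ← ih]
    ring

/-- Connectedness: around a crossing, the left side of an edge is joined to the left side of the
next edge through corners and across one other strand. -/
theorem eq_of_left_eq_right {A : Type*} (h : C.Region → A) (hh : ∀ e, h (C.left e) = h (C.right e))
    (f : C.Region) : h f = h (C.left 0) := by
  have key : ∀ e, h (C.left e) = h (C.left 0) := by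
    intro e
    induction e using edge_induction with
    | h0 => rfl
    | hs p ih =>
      rw [← ih]
      obtain ⟨x, rfl | rfl⟩ := C.exists_rising_or_falling p
      · rw [← C.north, ← hh, ← C.west]
      · rw [← C.west, hh, ← C.south]
  obtain ⟨e, rfl | rfl⟩ := C.cover f
  · exact key e
  · rw [← hh, key e]

theorem isCirculation_potential {K : Type*} [AddCommGroup K] (h : C.Region → K) :
    C.IsCirculation (fun e => h (C.left e) - h (C.right e)) := by
  intro x
  simp only [← C.west, C.south, ← C.north, ← C.east]
  abel

/-- A dimension count. A circulation is determined by its value at `0` and its `N` jumps, which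
leaves dimension at most `N + 1`. The functions on the `N + 2` regions have only the constants in
the kernel of the difference map, whose image thus has dimension at least `N + 1`. This is the
vanishing of the first cohomology of the sphere. -/
theorem exists_potential_rat {g : Fin (2 * N) → ℚ} (hg : C.IsCirculation g) :
    ∃ h : C.Region → ℚ, ∀ e, g e = h (C.left e) - h (C.right e) := by
  let S : Submodule ℚ (Fin (2 * N) → ℚ) :=
    { carrier := {g | C.IsCirculation g}
      add_mem' := fun {a b} ha hb x => by
        have := ha x; have := hb x
        simp only [Pi.add_apply]; linarith
      zero_mem' := fun x => by simp
      smul_mem' := fun c a ha x => by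
        have := ha x
        simp only [Pi.smul_apply, smul_eq_mul, ← mul_add, this] }
  let Δ : (C.Region → ℚ) →ₗ[ℚ] (Fin (2 * N) → ℚ) :=
    { toFun := fun h e => h (C.left e) - h (C.right e)
      map_add' := fun a b => by ext e; simp only [Pi.add_apply]; ring
      map_smul' := fun c a => by ext e; simp only [Pi.smul_apply, smul_eq_mul, RingHom.id_apply]; ring }
  let J : S →ₗ[ℚ] (ℚ × (Fin N → ℚ)) :=
    { toFun := fun g => (g.1 0, C.jump g.1)
      map_add' := fun a b => by
        ext
        · simp
        · simp only [jump, Submodule.coe_add, Pi.add_apply, Prod.mk_add_mk]; ring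
      map_smul' := fun c a => by
        ext
        · simp
        · simp only [jump, Submodule.coe_smul, Pi.smul_apply, Prod.smul_mk, smul_eq_mul,
            RingHom.id_apply]; ring }
  have hJ : Function.Injective J := by
    rw [← LinearMap.ker_eq_bot, LinearMap.ker_eq_bot']
    intro a ha
    have h0 : a.1 0 = 0 := congrArg Prod.fst ha
    have h1 : ∀ x, C.jump a.1 x = 0 := fun x => congrFun (congrArg Prod.snd ha) x
    ext e
    rw [C.circulation_eq a.2 e, h0]
    simp [h1]
  have d1 : Module.finrank ℚ S ≤ N + 1 := by
    refine (LinearMap.finrank_le_finrank_of_injective hJ).trans ?_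
    simp [add_comm]
  let I : LinearMap.ker Δ →ₗ[ℚ] ℚ := (LinearMap.proj (C.left 0)).comp (LinearMap.ker Δ).subtype
  have hI : Function.Injective I := by
    rw [← LinearMap.ker_eq_bot, LinearMap.ker_eq_bot']
    intro a ha
    ext f
    have h2 : ∀ e, a.1 (C.left e) = a.1 (C.right e) := fun e =>
      sub_eq_zero.1 (congrFun (LinearMap.mem_ker.1 a.2) e)
    rw [C.eq_of_left_eq_right a.1 h2 f]
    exact ha
  have d2 : Module.finrank ℚ (LinearMap.ker Δ) ≤ 1 := by
    refine (LinearMap.finrank_le_finrank_of_injective hI).trans ?_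
    simp
  have d3 := LinearMap.finrank_range_add_finrank_ker Δ
  rw [Module.finrank_fintype_fun_eq_card, C.card_region] at d3
  have hle : LinearMap.range Δ ≤ S := by
    rintro _ ⟨h, rfl⟩
    exact C.isCirculation_potential h
  have := Submodule.eq_of_le_of_finrank_le hle (by omega)
  have hg' : g ∈ LinearMap.range Δ := by rw [this]; exact hg
  obtain ⟨h, hh⟩ := hg'
  exact ⟨h, fun e => (congrFun hh e).symm⟩

/-- A rational potential is integral once normalized at one region, because integrality passes
across every edge. -/
theorem exists_potential {g : Fin (2 * N) → ℤ} (hg : C.IsCirculation g) :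
    ∃ h : C.Region → ℤ, h (C.left 0) = 0 ∧ ∀ e, h (C.left e) - h (C.right e) = g e := by
  have hg' : C.IsCirculation (fun e => (g e : ℚ)) := fun x => by
    have := hg x
    simp only
    exact_mod_cast this
  obtain ⟨h, hh⟩ := C.exists_potential_rat hg'
  have hint : ∀ f, ∃ z : ℤ, h f - h (C.left 0) = z := by
    intro f
    have := C.eq_of_left_eq_right (fun f => ∃ z : ℤ, h f - h (C.left 0) = z) (by
      intro e
      have := hh e
      refine propext ⟨?_, ?_⟩
      · rintro ⟨z, hz⟩
        exact ⟨z - g e, by push_cast; linarith⟩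
      · rintro ⟨z, hz⟩
        exact ⟨z + g e, by push_cast; linarith⟩) f
    rw [this]
    exact ⟨0, by simp⟩
  choose k hk using hint
  refine ⟨k, ?_, fun e => ?_⟩
  · have := hk (C.left 0)
    rw [sub_self] at this
    exact_mod_cast this.symm
  · have h1 := hk (C.left e)
    have h2 := hk (C.right e)
    have h3 := hh e
    have : ((k (C.left e) - k (C.right e) : ℤ) : ℚ) = g e := by push_cast; linarith
    exact_mod_cast this

theorem isCirculation_one : C.IsCirculation (fun _ => (1 : ℤ)) := fun _ => rfl

/-- The Alexander numbering of the regions, `0` to the left of the marked edge. -/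
def alexander : C.Region → ℤ := (C.exists_potential C.isCirculation_one).choose

theorem alexander_left_zero : C.alexander (C.left 0) = 0 :=
  (C.exists_potential C.isCirculation_one).choose_spec.1

theorem alexander_sub (e : Fin (2 * N)) : C.alexander (C.left e) - C.alexander (C.right e) = 1 :=
  (C.exists_potential C.isCirculation_one).choose_spec.2 e

theorem left_ne_right (e : Fin (2 * N)) : C.left e ≠ C.right e := by
  intro h
  have := C.alexander_sub e
  rw [h] at this
  simp at this

/-- The winding numbers of the loop of a crossing about the regions. -/
def winding (x : Fin N) : C.Region → ℤ := (C.exists_potential (C.isCirculation_loop x)).choose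

theorem winding_left_zero (x : Fin N) : C.winding x (C.left 0) = 0 :=
  (C.exists_potential (C.isCirculation_loop x)).choose_spec.1

theorem winding_sub (x : Fin N) (e : Fin (2 * N)) :
    C.winding x (C.left e) - C.winding x (C.right e) = C.loop x e :=
  (C.exists_potential (C.isCirculation_loop x)).choose_spec.2 e

/-- The potential of a circulation, normalized to be `0` to the left of the marked edge. -/
def pot (g : Fin (2 * N) → ℤ) (f : C.Region) : ℤ :=
  g 0 * C.alexander f + ∑ x, C.jump g x * C.winding x f

theorem pot_left_zero (g : Fin (2 * N) → ℤ) : C.pot g (C.left 0) = 0 := by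
  simp [pot, alexander_left_zero, winding_left_zero]

theorem pot_sub {g : Fin (2 * N) → ℤ} (hg : C.IsCirculation g) (e : Fin (2 * N)) :
    C.pot g (C.left e) - C.pot g (C.right e) = g e := by
  have h1 := C.circulation_eq hg e
  have h2 : ∑ x, C.jump g x * (C.loop x e) =
      ∑ x, C.jump g x * C.winding x (C.left e) - ∑ x, C.jump g x * C.winding x (C.right e) := by
    rw [← Finset.sum_sub_distrib]
    exact Finset.sum_congr rfl fun x _ => by rw [← C.winding_sub]; ring
  simp only [Int.cast_id] at h1
  rw [h2] at h1
  rw [pot, pot]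
  linear_combination - h1 + g 0 * C.alexander_sub e

/-- Two potentials of the same circulation differ by a constant. -/
theorem potential_eq_pot (h : C.Region → ℤ) (f : C.Region) :
    h f - h (C.left 0) = C.pot (fun e => h (C.left e) - h (C.right e)) f := by
  have h1 := C.eq_of_left_eq_right
    (fun f => h f - C.pot (fun e => h (C.left e) - h (C.right e)) f) (fun e => by
      have := C.pot_sub (C.isCirculation_potential h) e
      linarith) f
  simp only [pot_left_zero] at h1
  linarith

/-- The formula that defines `pot` is linear in `g`, so no conservation at the crossings is needed.
-/
theorem pot_sub_loop (g : Fin (2 * N) → ℤ) (x : Fin N) (f : C.Region) :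
    C.pot (fun e => g e - C.loop x e) f = C.pot g f - C.winding x f := by
  have : ∀ y, C.jump (fun e => g e - C.loop x e) y = C.jump g y - if x = y then 1 else 0 := by
    intro y
    rw [← C.jump_loop x y]
    simp only [jump]
    ring
  simp only [pot, this, loop_zero, sub_mul, Finset.sum_sub_distrib]
  simp
  ring

end ClosedDiagram

/-! ### Turning of the regions, and the framing of an operator that moves along the curve. -/

namespace ClosedDiagram

variable {N : ℕ} [NeZero (2 * N)] (C : ClosedDiagram N)

theorem sum_shift {A : Type*} [AddCommMonoid A] {M : ℕ} [NeZero M] (f : Fin M → A) :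
    ∑ p, f (p + 1) = ∑ p, f p :=
  Equiv.sum_comp (Equiv.addRight (1 : Fin M)) f

/-- The rotation numbers of the edges of a diagram in the plane with unbounded region `f₀`, which
lies to the left of the boundary of the diagram: the boundary of `f₀` makes a full turn clockwise,
and the boundaries of the other regions make one counterclockwise. -/
def Admissible (rot : Fin (2 * N) → ℤ) (f₀ : C.Region) : Prop :=
  ∀ f, 2 * (∑ e, if C.left e = f then rot e else 0) - 2 * (∑ e, if C.right e = f then rot e else 0)
    + (∑ x, if C.left (C.falling x) = f then 1 else 0)
    + (∑ x, if C.right (C.falling x + 1) = f then 1 else 0) = 2 - if f = f₀ then 4 else 0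

theorem sum_mul_sum_ite {ι A : Type*} [Fintype ι] [Fintype A] [DecidableEq A] (h : A → ℤ)
    (φ : ι → A) (r : ι → ℤ) :
    ∑ f, h f * ∑ i, (if φ i = f then r i else 0) = ∑ i, h (φ i) * r i := by
  simp only [Finset.mul_sum]
  rw [Finset.sum_comm]
  refine Finset.sum_congr rfl fun i _ => ?_
  simp

theorem Admissible.pairing {C : ClosedDiagram N} {rot : Fin (2 * N) → ℤ} {f₀ : C.Region}
    (hr : C.Admissible rot f₀) (h : C.Region → ℤ) :
    2 * ∑ e, (h (C.left e) - h (C.right e)) * rot e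
      + ∑ x, (h (C.left (C.falling x)) + h (C.left (C.rising x + 1)))
      = 2 * ∑ f, h f - 4 * h f₀ := by
  have h1 : ∑ f, h f * (2 * (∑ e, if C.left e = f then rot e else 0)
      - 2 * (∑ e, if C.right e = f then rot e else 0)
      + (∑ x, if C.left (C.falling x) = f then 1 else 0)
      + (∑ x, if C.right (C.falling x + 1) = f then 1 else 0))
      = ∑ f, h f * (2 - if f = f₀ then 4 else 0) :=
    Finset.sum_congr rfl fun f _ => by rw [hr f]
  simp only [mul_add, mul_sub, Finset.sum_add_distrib, Finset.sum_sub_distrib,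
    mul_left_comm (h _) (2 : ℤ), ← Finset.mul_sum, sum_mul_sum_ite] at h1
  simp only [sub_mul, Finset.sum_add_distrib, Finset.sum_sub_distrib, ← C.north]
  simp only [mul_one, mul_ite, mul_zero, Finset.sum_ite_eq', Finset.mem_univ, if_true,
    ← Finset.sum_mul] at h1
  linarith

/-- Every edge ends at one crossing and begins at one, so its left region is counted once at a west
or south corner and once at a west or north corner; the west corners cancel. -/
theorem sum_south_eq_sum_north (h : C.Region → ℤ) :
    ∑ x, h (C.left (C.falling x)) = ∑ x, h (C.left (C.rising x + 1)) := by
  have h1 := sum_shift (fun e => h (C.left e))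
  rw [C.sum_passages, C.sum_passages, Finset.sum_add_distrib, Finset.sum_add_distrib] at h1
  simp only [← C.west] at h1
  linarith

/-- A trace identity: `potential_eq_pot` for the indicator function of a region, evaluated at that
same region, is a diagonal entry; these are multiplied by `h` and summed. -/
theorem sum_corners_winding (h : C.Region → ℤ) :
    ∑ x, (h (C.left (C.rising x + 1)) * C.winding x (C.left (C.rising x + 1))
      - h (C.right (C.falling x)) * C.winding x (C.right (C.falling x))
      - h (C.left (C.rising x)) * C.winding x (C.left (C.rising x))
      + h (C.left (C.falling x)) * C.winding x (C.left (C.falling x)))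
    = ∑ f, h f - h (C.left 0) - h (C.right 0) := by
  have h1 : ∀ f₀, h f₀ * (1 - if C.left 0 = f₀ then 1 else 0) =
      h f₀ * (((if C.left 0 = f₀ then 1 else 0) - if C.right 0 = f₀ then 1 else 0)
        * C.alexander f₀) +
      ∑ x, (((if C.left (C.rising x + 1) = f₀ then 1 else 0)
        - (if C.right (C.falling x) = f₀ then 1 else 0)
        - (if C.left (C.rising x) = f₀ then 1 else 0)
        + (if C.left (C.falling x) = f₀ then 1 else 0)) * (h f₀ * C.winding x f₀)) := by
    intro f₀
    have := C.potential_eq_pot (fun f => if f = f₀ then 1 else 0) f₀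
    simp only [if_true] at this
    rw [this, pot, mul_add, Finset.mul_sum]
    congr 1
    refine Finset.sum_congr rfl fun x _ => ?_
    simp only [jump, ← C.east, C.south]
    ring
  have h2 := Finset.sum_congr rfl fun f₀ (_ : f₀ ∈ Finset.univ) => h1 f₀
  have h3 := C.alexander_sub 0
  rw [C.alexander_left_zero] at h3
  rw [Finset.sum_add_distrib, Finset.sum_comm (s := Finset.univ (α := C.Region))] at h2
  simp only [mul_sub, sub_mul, add_mul, ite_mul, one_mul, zero_mul, mul_ite, mul_one, mul_zero,
    Finset.sum_sub_distrib, Finset.sum_add_distrib, Finset.sum_ite_eq, Finset.mem_univ, if_true,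
    C.alexander_left_zero] at h2
  simp only [Finset.sum_sub_distrib, Finset.sum_add_distrib]
  have h4 : C.alexander (C.right 0) = -1 := by linarith
  rw [h4] at h2
  linarith

/-- The crossings and their strands, as passages. -/
def passageEquiv : Fin N ⊕ Fin N ≃ Fin (2 * N) :=
  Equiv.ofBijective _ C.bijective_rising_falling

/-- The change at a passage of the framing of an inserted operator. -/
def framingJump (p : Fin (2 * N)) : ℤ :=
  Sum.elim (fun x => -2 * after (C.rising x) (C.falling x))
    (fun x => 2 * after (C.falling x) (C.rising x)) (C.passageEquiv.symm p)

theorem framingJump_rising (x : Fin N) :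
    C.framingJump (C.rising x) = -2 * after (C.rising x) (C.falling x) := by
  have : C.passageEquiv.symm (C.rising x) = Sum.inl x := by
    rw [Equiv.symm_apply_eq]; rfl
  rw [framingJump, this]; rfl

theorem framingJump_falling (x : Fin N) :
    C.framingJump (C.falling x) = 2 * after (C.falling x) (C.rising x) := by
  have : C.passageEquiv.symm (C.falling x) = Sum.inr x := by
    rw [Equiv.symm_apply_eq]; rfl
  rw [framingJump, this]; rfl

/-- The framing of an operator inserted at the end of an edge. -/
def framing (rot : Fin (2 * N) → ℤ) (e : Fin (2 * N)) : ℤ :=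
  ∑ p, after p e * (C.framingJump p - 2 * rot p) - 2 * rot e

theorem framing_zero (rot : Fin (2 * N) → ℤ) : C.framing rot 0 = - (2 * rot 0) := by
  simp [framing, after_zero]

/-- The framing accumulates along the curve; the last term resets it at the marked edge. -/
theorem framing_succ (rot : Fin (2 * N) → ℤ) (p : Fin (2 * N)) :
    C.framing rot (p + 1) + 2 * rot (p + 1) = C.framing rot p + C.framingJump p
      - if p + 1 = 0 then ∑ q, (C.framingJump q - 2 * rot q) else 0 := by
  simp only [framing, after_succ, sub_mul, add_mul, Finset.sum_sub_distrib, Finset.sum_add_distrib]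
  split_ifs <;> simp <;> ring

theorem after_add_after {M : ℕ} {p q : Fin M} (h : p ≠ q) : after p q + after q p = 1 := by
  rcases lt_or_gt_of_ne h with h | h
  · simp [after, h, h.not_gt]
  · simp [after, h, h.not_gt]

theorem after_self {M : ℕ} (p : Fin M) : after p p = 0 := by simp [after]

theorem winding_south (x : Fin N) : C.winding x (C.left (C.falling x)) =
    C.winding x (C.left (C.rising x)) + after (C.falling x) (C.rising x) := by
  have := C.winding_sub x (C.rising x)
  rw [← C.south, loop, after_self] at this
  linarith

theorem winding_east (x : Fin N) : C.winding x (C.right (C.falling x)) =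
    C.winding x (C.left (C.falling x)) - after (C.rising x) (C.falling x) := by
  have := C.winding_sub x (C.falling x)
  rw [loop, after_self] at this
  linarith

theorem winding_north (x : Fin N) : C.winding x (C.left (C.rising x + 1)) =
    C.winding x (C.left (C.rising x)) + 1 - after (C.rising x) (C.falling x) := by
  have := C.winding_sub x (C.falling x + 1)
  rw [← C.west, C.north, loop_succ, if_neg (C.rising_ne_falling _ _), if_pos rfl, loop,
    after_self] at this
  linarith

/-- The turning conditions paired with `h`. The brackets are the obstructions to a consistent
framing, at the crossings and after one full tour; as `h` is arbitrary, each of them can be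
isolated. -/
theorem framing_defect (rot : Fin (2 * N) → ℤ) (hr : C.Admissible rot (C.left 0))
    (h : C.Region → ℤ) :
    ∑ x, C.jump (fun e => h (C.left e) - h (C.right e)) x *
        (C.framing rot (C.falling x) + C.framingJump (C.falling x) - C.framing rot (C.rising x)
          + 2 * C.winding x (C.left (C.rising x)))
      + (h (C.left 0) - h (C.right 0)) * (∑ q, (C.framingJump q - 2 * rot q) - 2) = 0 := by
  set c : Fin (2 * N) → ℤ := fun e => h (C.left e) - h (C.right e) with hc
  set K := ∑ q, (C.framingJump q - 2 * rot q) with hK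
  -- Summation by parts around the closed curve; the reset at the marked edge contributes `c 0 * K`.
  have e1 : ∑ p, (c p * C.framing rot p - c (p + 1) * (C.framing rot p + C.framingJump p))
      + c 0 * K = - (2 * ∑ e, c e * rot e) := by
    have h1 : ∑ p, c (p + 1) * (C.framing rot (p + 1) + 2 * rot (p + 1))
        = ∑ p, c p * (C.framing rot p + 2 * rot p) :=
      sum_shift (fun p => c p * (C.framing rot p + 2 * rot p))
    have h2 : ∑ p : Fin (2 * N), c (p + 1) * (if p + 1 = 0 then K else 0) = c 0 * K := by
      rw [sum_shift (fun p : Fin (2 * N) => c p * (if p = 0 then K else 0))]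
      simp
    simp only [framing_succ, ← hK] at h1
    simp only [mul_sub, Finset.sum_sub_distrib] at h1
    rw [h2] at h1
    simp only [mul_add, Finset.sum_add_distrib, Finset.sum_sub_distrib, Finset.mul_sum,
      mul_left_comm (2 : ℤ)] at h1 ⊢
    linarith
  -- The two passages of a crossing together give the jump times the obstruction, plus corner terms
  -- that `sum_corners_winding` evaluates.
  have e2 : ∀ x, (c (C.rising x) * C.framing rot (C.rising x)
        - c (C.rising x + 1) * (C.framing rot (C.rising x) + C.framingJump (C.rising x)))
      + (c (C.falling x) * C.framing rot (C.falling x)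
        - c (C.falling x + 1) * (C.framing rot (C.falling x) + C.framingJump (C.falling x)))
      = C.jump c x * (C.framing rot (C.falling x) + C.framingJump (C.falling x)
          - C.framing rot (C.rising x) + 2 * C.winding x (C.left (C.rising x)))
        - 2 * (h (C.left (C.rising x + 1)) * C.winding x (C.left (C.rising x + 1))
          - h (C.right (C.falling x)) * C.winding x (C.right (C.falling x))
          - h (C.left (C.rising x)) * C.winding x (C.left (C.rising x))
          + h (C.left (C.falling x)) * C.winding x (C.left (C.falling x)))
        + 2 * h (C.left (C.rising x + 1)) := by
    intro x
    have h1 := after_add_after (C.rising_ne_falling x x)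
    rw [framingJump_rising, framingJump_falling, winding_east, winding_south, winding_north, jump]
    simp only [hc, C.east, ← C.south, ← C.west, C.north]
    rw [show after (C.falling x) (C.rising x) = 1 - after (C.rising x) (C.falling x) by linarith]
    ring
  rw [C.sum_passages, Finset.sum_congr rfl fun x _ => e2 x, Finset.sum_add_distrib,
    Finset.sum_sub_distrib, ← Finset.mul_sum, ← Finset.mul_sum, sum_corners_winding] at e1
  have e3 := hr.pairing h
  rw [Finset.sum_add_distrib, sum_south_eq_sum_north] at e3
  have e4 : c 0 = h (C.left 0) - h (C.right 0) := rfl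
  rw [← e4]
  have e5 : ∑ e, c e * rot e = ∑ e, (h (C.left e) - h (C.right e)) * rot e := rfl
  rw [← e5] at e3
  linarith

/-- The test function is the Alexander numbering, whose differences are constant and have no jumps.
This is Whitney's formula for the rotation number of a closed plane curve. -/
theorem framing_total (rot : Fin (2 * N) → ℤ) (hr : C.Admissible rot (C.left 0)) :
    ∑ q, (C.framingJump q - 2 * rot q) = 2 := by
  have := C.framing_defect rot hr C.alexander
  simp only [alexander_sub, jump, sub_self, zero_mul, Finset.sum_const_zero] at this
  linarith

/-- The test function is the winding number of the loop at `x`, whose differences jump only at `x`.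
-/
theorem framing_falling (rot : Fin (2 * N) → ℤ) (hr : C.Admissible rot (C.left 0)) (x : Fin N) :
    C.framing rot (C.falling x) + C.framingJump (C.falling x) =
      C.framing rot (C.rising x) - 2 * C.winding x (C.left (C.rising x)) := by
  have := C.framing_defect rot hr (C.winding x)
  simp only [winding_sub] at this
  rw [show (fun e => C.loop x e) = C.loop x from rfl] at this
  simp only [jump_loop, loop_zero] at this
  simp at this
  linarith

end ClosedDiagram

/-- The colorings of `M` edges by `0, …, n - 1`. -/
def colorings (M n : ℕ) : Finset (Fin M → ℤ) := Fintype.piFinset fun _ => Finset.Ico 0 (n : ℤ)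

theorem mem_colorings {M n : ℕ} {col : Fin M → ℤ} :
    col ∈ colorings M n ↔ ∀ e, 0 ≤ col e ∧ col e < n := by
  simp [colorings]

/-- Reindexing by a shift of one color; the colorings that would leave the range contribute zero. -/
theorem sum_colorings_shift {M n : ℕ} {A : Type*} [AddCommMonoid A] (e : Fin M)
    (f g : (Fin M → ℤ) → A) (hfg : ∀ col : Fin M → ℤ, 0 ≤ col e → f (col + Pi.single e 1) = g col)
    (hf : ∀ col : Fin M → ℤ, col e = 0 → f col = 0) (hg : ∀ col : Fin M → ℤ, col e = (n : ℤ) - 1 → g col = 0) :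
    ∑ col ∈ colorings M n, f col = ∑ col ∈ colorings M n, g col := by
  refine Finset.sum_bij_ne_zero (fun col _ _ => col - Pi.single e 1) ?_ ?_ ?_ ?_
  · intro col hc h0
    rw [mem_colorings] at hc ⊢
    intro i
    have h1 := hc i
    by_cases hi : i = e
    · subst hi
      have : col i ≠ 0 := fun h => h0 (hf col h)
      simp only [Pi.sub_apply, Pi.single_eq_same]
      omega
    · simpa [Pi.single_eq_of_ne hi] using h1
  · intro c1 _ _ c2 _ _ h
    exact sub_left_injective h
  · intro col hc h0
    refine ⟨col + Pi.single e 1, ?_, ?_, by simp⟩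
    · rw [mem_colorings] at hc ⊢
      intro i
      have h1 := hc i
      by_cases hi : i = e
      · subst hi
        have : col i ≠ (n : ℤ) - 1 := fun h => h0 (hg col h)
        simp only [Pi.add_apply, Pi.single_eq_same]
        omega
      · simpa [Pi.single_eq_of_ne hi] using h1
    · rwa [hfg _ (mem_colorings.1 hc e).1]
  · intro col hc h0
    have h1 := (mem_colorings.1 hc e).1
    have h2 : col e ≠ 0 := fun h => h0 (hf col h)
    rw [← hfg, sub_add_cancel]
    simp only [Pi.sub_apply, Pi.single_eq_same]
    omega

/-! ### Sliding a raising operator along the curve. -/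

namespace ClosedDiagram

variable {N : ℕ} [NeZero (2 * N)] (C : ClosedDiagram N)

/-- The product of the crossing weights, where the ends of the edges are colored by `i` and their
beginnings by `o`. -/
def vertexWeight (n : ℕ) (i o : Fin (2 * N) → ℤ) : ℤ[T;T⁻¹] :=
  ∏ x, crossingWeight (C.positive x) n (i (C.rising x)) (i (C.falling x))
    (o (C.falling x + 1)) (o (C.rising x + 1))

/-- The exponent of the contribution of the local extrema. -/
def rotExponent {M : ℕ} (rot : Fin M → ℤ) (n : ℕ) (col : Fin M → ℤ) : ℤ :=
  ∑ e, rot e * ((n : ℤ) - 1 - 2 * col e)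

/-- The state sum over all colorings in which the edge `e` has color `a`. -/
def stateSum (rot : Fin (2 * N) → ℤ) (n : ℕ) (e : Fin (2 * N)) (a : ℤ) : ℤ[T;T⁻¹] :=
  ∑ col ∈ colorings (2 * N) n,
    if col e = a then C.vertexWeight n col col * T (2 * rotExponent rot n col) else 0

theorem rotExponent_add_single {M : ℕ} (rot : Fin M → ℤ) (n : ℕ) (col : Fin M → ℤ) (e : Fin M) :
    rotExponent rot n (col + Pi.single e 1) = rotExponent rot n col - 2 * rot e := by
  have : ∀ i, rot i * ((n : ℤ) - 1 - 2 * (col + Pi.single e 1 : Fin M → ℤ) i)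
      = rot i * ((n : ℤ) - 1 - 2 * col i) - 2 * (rot i * (Pi.single e 1 : Fin M → ℤ) i) := by
    intro i
    simp only [Pi.add_apply]
    ring
  simp only [rotExponent, this, Finset.sum_sub_distrib, ← Finset.mul_sum]
  simp [Pi.single_apply]

/-- The exponent of the tail of a raising operator at the end of the edge `e`. -/
def tailIn (rot : Fin (2 * N) → ℤ) (n : ℕ) (e : Fin (2 * N)) (col : Fin (2 * N) → ℤ) : ℤ :=
  ((n : ℤ) - 1) * C.alexander (C.left e) - 2 * C.pot (fun i => col i + after e i) (C.left e)
    + C.framing rot e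

/-- The exponent of the tail of a raising operator just after the passage `p`. -/
def tailOut (rot : Fin (2 * N) → ℤ) (n : ℕ) (p : Fin (2 * N)) (col : Fin (2 * N) → ℤ) : ℤ :=
  ((n : ℤ) - 1) * C.alexander (C.left (p + 1))
    - 2 * C.pot (fun i => col i + after p i) (C.left (p + 1))
    + (C.framing rot p + C.framingJump p)

/-- The weight of a coloring with a raising operator at the end of the edge `e`; the color of the
last piece of the marked edge `0` is less by one than that of its first piece. -/
def raisedIn (rot : Fin (2 * N) → ℤ) (n : ℕ) (e : Fin (2 * N)) (col : Fin (2 * N) → ℤ) :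
    ℤ[T;T⁻¹] :=
  C.vertexWeight n (col - Pi.single e 1) (col - Pi.single 0 1) * raising n (col e)
    * T (2 * (rotExponent rot n col - C.tailIn rot n e col))

/-- The weight of a coloring with a raising operator just after the passage `p`. -/
def raisedOut (rot : Fin (2 * N) → ℤ) (n : ℕ) (p : Fin (2 * N)) (col : Fin (2 * N) → ℤ) :
    ℤ[T;T⁻¹] :=
  C.vertexWeight n col (col - Pi.single 0 1 + Pi.single (p + 1) 1)
    * qInt (n - (col - Pi.single 0 1 : Fin (2 * N) → ℤ) (p + 1) - 1)
    * T (2 * (rotExponent rot n col - C.tailOut rot n p col))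

theorem single_apply_of_ne {M : ℕ} {i j : Fin M} (h : j ≠ i) :
    (Pi.single i 1 : Fin M → ℤ) j = 0 := Pi.single_eq_of_ne h 1

/-- The raising operator commutes with the weight of each crossing. -/
theorem raised_crossing {rot : Fin (2 * N) → ℤ} (hr : C.Admissible rot (C.left 0)) (n : ℕ)
    {col : Fin (2 * N) → ℤ} (hcol : col ∈ colorings (2 * N) n) (h0 : 1 ≤ col 0) (x : Fin N) :
    C.raisedIn rot n (C.rising x) col + C.raisedIn rot n (C.falling x) col
      = C.raisedOut rot n (C.rising x) col + C.raisedOut rot n (C.falling x) col := by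
  classical
  rw [mem_colorings] at hcol
  set o : Fin (2 * N) → ℤ := col - Pi.single 0 1 with ho
  have ho0 : ∀ e, 0 ≤ o e := by
    intro e
    have := hcol e
    by_cases he : e = 0
    · subst he
      simp only [ho, Pi.sub_apply, Pi.single_eq_same]
      omega
    · simp only [ho, Pi.sub_apply, single_apply_of_ne he]
      omega
  -- The weights of the other crossings are common to all four terms.
  set P : ℤ[T;T⁻¹] := ∏ y ∈ Finset.univ.erase x, crossingWeight (C.positive y) n (col (C.rising y))
    (col (C.falling y)) (o (C.falling y + 1)) (o (C.rising y + 1)) with hP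
  have hrf := C.rising_ne_falling
  have hfr : ∀ x y, C.falling x ≠ C.rising y := fun x y => (hrf y x).symm
  have w : ∀ i' o' : Fin (2 * N) → ℤ, (∀ y, y ≠ x → i' (C.rising y) = col (C.rising y) ∧
      i' (C.falling y) = col (C.falling y) ∧ o' (C.falling y + 1) = o (C.falling y + 1) ∧
      o' (C.rising y + 1) = o (C.rising y + 1)) → C.vertexWeight n i' o' =
        crossingWeight (C.positive x) n (i' (C.rising x)) (i' (C.falling x))
          (o' (C.falling x + 1)) (o' (C.rising x + 1)) * P := by
    intro i' o' h
    rw [vertexWeight, ← Finset.mul_prod_erase _ _ (Finset.mem_univ x), hP]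
    congr 1
    refine Finset.prod_congr rfl fun y hy => ?_
    obtain ⟨h1, h2, h3, h4⟩ := h y (Finset.ne_of_mem_erase hy)
    rw [h1, h2, h3, h4]
  have hne : ∀ y, y ≠ x → C.rising y ≠ C.rising x ∧ C.falling y ≠ C.falling x := fun y hy =>
    ⟨fun h => hy (C.rising_injective h), fun h => hy (C.falling_injective h)⟩
  have w1 := w (col - Pi.single (C.rising x) 1) o (fun y hy => by
    simp [hne y hy, hfr])
  have w2 := w (col - Pi.single (C.falling x) 1) o (fun y hy => by
    simp [hne y hy, hrf])
  have w3 := w col (o + Pi.single (C.rising x + 1) 1) (fun y hy => by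
    simp [hne y hy, hfr])
  have w4 := w col (o + Pi.single (C.falling x + 1) 1) (fun y hy => by
    simp [hne y hy, hrf])
  simp only [Pi.sub_apply, Pi.single_eq_same, single_apply_of_ne (hfr x x),
    single_apply_of_ne (hrf x x), sub_zero] at w1 w2
  simp only [Pi.add_apply, Pi.single_eq_same,
    single_apply_of_ne (show C.falling x + 1 ≠ C.rising x + 1 by simpa using hfr x x),
    single_apply_of_ne (show C.rising x + 1 ≠ C.falling x + 1 by simpa using hrf x x),
    add_zero] at w3 w4
  simp only [raisedIn, raisedOut, ← ho]
  rw [w1, w2, w3, w4]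
  by_cases hs : col (C.rising x) + col (C.falling x) = o (C.falling x + 1) + o (C.rising x + 1) + 1
  swap
  · rw [crossingWeight_of_ne (by omega), crossingWeight_of_ne (by omega),
      crossingWeight_of_ne (by omega), crossingWeight_of_ne (by omega)]
    simp
  by_cases hP0 : P = 0
  · simp [hP0]
  have hcons : ∀ y, y ≠ x →
      col (C.rising y) + col (C.falling y) = o (C.falling y + 1) + o (C.rising y + 1) := by
    intro y hy
    by_contra h
    exact hP0 (Finset.prod_eq_zero (Finset.mem_erase.2 ⟨hy, Finset.mem_univ y⟩)
      (crossingWeight_of_ne h))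
  -- Beyond the operator the color is one less. Adding the unit back gives a circulation, also at
  -- the marked edge, which begins with color `col 0 - 1`.
  set g : Fin (2 * N) → ℤ := fun i => col i + after (C.rising x) i with hg
  have hstep : ∀ p, g (p + 1) = o (p + 1) + after (C.rising x) p
      + if C.rising x = p then 1 else 0 := by
    intro p
    simp only [hg, ho, after_succ, Pi.sub_apply, Pi.single_apply]
    ring
  have hcirc : C.IsCirculation g := by
    intro y
    rw [hstep, hstep, if_neg (hrf x y)]
    simp only [hg, C.rising_injective.eq_iff]
    by_cases hy : x = y
    · subst hy
      rw [if_pos rfl]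
      linarith
    · rw [if_neg hy]
      linarith [hcons y (Ne.symm hy)]
  have hfall : (fun i => col i + after (C.falling x) i) = fun i => g i - C.loop x i := by
    ext i
    simp only [hg, loop]
    ring
  have a1 := C.alexander_sub (C.rising x)
  rw [← C.south] at a1
  have a2 := C.alexander_sub (C.falling x + 1)
  rw [← C.west, C.north] at a2
  have g1 := C.pot_sub hcirc (C.rising x)
  rw [← C.south] at g1
  have g2 := C.pot_sub hcirc (C.falling x + 1)
  rw [← C.west, C.north, hstep, if_neg (hrf x x)] at g2
  have k1 := C.framing_falling rot hr x
  have k2 := C.framingJump_rising x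
  have k3 := C.framingJump_falling x
  have s1 : g (C.rising x) = col (C.rising x) := by simp [hg, after_self]
  rw [s1] at g1
  -- Compared with the lower left end, the tail from the upper left end is the same, and those from
  -- the lower right and upper right ends cross one more strand: these are the factors `K` of the
  -- coproduct.
  have t2 : rotExponent rot n col - C.tailIn rot n (C.falling x) col =
      rotExponent rot n col - C.tailIn rot n (C.rising x) col
        + ((n : ℤ) - 1 - 2 * col (C.rising x)) := by
    simp only [tailIn]
    rw [hfall, pot_sub_loop, winding_south, ← hg]
    linear_combination ((n : ℤ) - 1) * a1 - 2 * g1 - k1 + k3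
  have t4 : rotExponent rot n col - C.tailOut rot n (C.falling x) col =
      rotExponent rot n col - C.tailIn rot n (C.rising x) col := by
    simp only [tailIn, tailOut]
    rw [hfall, pot_sub_loop, ← C.west]
    linear_combination - k1
  have t3 : rotExponent rot n col - C.tailOut rot n (C.rising x) col =
      rotExponent rot n col - C.tailIn rot n (C.rising x) col
        + ((n : ℤ) - 1 - 2 * o (C.falling x + 1)) := by
    simp only [tailIn, tailOut]
    rw [← hg]
    linear_combination - k2 + ((n : ℤ) - 1) * a2 - 2 * g2
  rw [t2, t3, t4, mul_add, mul_add, LaurentPolynomial.T_add, LaurentPolynomial.T_add]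
  have key := crossingWeight_raising (C.positive x) n (hcol (C.rising x)).1 (hcol (C.falling x)).1
    (ho0 (C.falling x + 1)) (ho0 (C.rising x + 1))
  linear_combination P * T (2 * (rotExponent rot n col - C.tailIn rot n (C.rising x) col)) * key

theorem vertexWeight_congr (n : ℕ) {i i' o o' : Fin (2 * N) → ℤ} (hi : i = i') (ho : o = o') :
    C.vertexWeight n i o = C.vertexWeight n i' o' := by rw [hi, ho]

/-- A raising operator can be moved along an edge other than the marked one. -/
theorem sum_raisedIn_eq_sum_raisedOut (rot : Fin (2 * N) → ℤ) (n : ℕ) (a : ℤ) {p : Fin (2 * N)}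
    (hp : p + 1 ≠ 0) :
    (∑ col ∈ colorings (2 * N) n, if col 0 = a then C.raisedIn rot n (p + 1) col else 0)
      = ∑ col ∈ colorings (2 * N) n, if col 0 = a then C.raisedOut rot n p col else 0 := by
  apply sum_colorings_shift (p + 1)
  · intro col hcol
    have h0 : (col + Pi.single (p + 1) 1 : Fin (2 * N) → ℤ) 0 = col 0 := by
      simp [Pi.single_eq_of_ne hp.symm]
    -- The unit added to the color of the edge `p + 1` makes up for the indicator starting one edge
    -- later, so both tails see the same potential.
    have ha : ∀ i, (col + Pi.single (p + 1) 1 : Fin (2 * N) → ℤ) i + after (p + 1) i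
        = col i + after p i := by
      intro i
      have hi := i.2
      rcases val_add_one_cases p with ⟨h, -⟩ | ⟨-, h⟩
      · exact absurd h hp
      · simp only [Pi.add_apply, Pi.single_apply, after, Fin.lt_def, Fin.ext_iff, h]
        split_ifs <;> omega
    rw [h0]
    congr 1
    rw [raisedIn, raisedOut, rotExponent_add_single]
    congr 1
    · congr 1
      · refine C.vertexWeight_congr n (by simp) ?_
        abel
      · rw [Pi.add_apply, Pi.single_eq_same, Pi.sub_apply, single_apply_of_ne hp, raising]
        split_ifs with h
        · omega
        · congr 1
          ring
    · congr 2
      simp only [tailIn, tailOut, ha]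
      have := C.framing_succ rot p
      rw [if_neg hp] at this
      linear_combination - this
  -- The boundary terms vanish: the operator kills color `0`, and `{0} = 0` at color `n - 1`.
  · intro col h
    simp [raisedIn, h, raising]
  · intro col h
    simp [raisedOut, h, single_apply_of_ne hp, qInt]

theorem sum_raisedIn_zero (rot : Fin (2 * N) → ℤ) {n : ℕ} {a : ℤ} (ha : 1 ≤ a) (han : a < n) :
    (∑ col ∈ colorings (2 * N) n, if col 0 = a then C.raisedIn rot n 0 col else 0)
      = qInt (n - a) * C.stateSum rot n 0 (a - 1) := by
  rw [stateSum, Finset.mul_sum]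
  apply sum_colorings_shift 0
  · intro col _
    rw [Pi.add_apply, Pi.single_eq_same]
    by_cases h : col 0 = a - 1
    · rw [if_pos h, if_pos (by omega), raisedIn, rotExponent_add_single, Pi.add_apply,
        Pi.single_eq_same, raising, if_neg (by omega), add_sub_cancel_right, tailIn,
        alexander_left_zero, pot_left_zero, framing_zero, show col 0 + 1 = a by omega]
      ring_nf
    · rw [if_neg h, if_neg (by omega), mul_zero]
  · intro col h
    rw [if_neg (by omega)]
  · intro col h
    rw [if_neg (by omega), mul_zero]

/-- The operator is back at the marked edge with the total framing `2`, which is the factor `T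
(-4)`. -/
theorem sum_raisedOut_last {rot : Fin (2 * N) → ℤ} (hr : C.Admissible rot (C.left 0)) (n : ℕ)
    (a : ℤ) {p : Fin (2 * N)} (hp : p + 1 = 0) :
    (∑ col ∈ colorings (2 * N) n, if col 0 = a then C.raisedOut rot n p col else 0)
      = qInt (n - a) * (T (-4) * C.stateSum rot n 0 a) := by
  rw [stateSum, Finset.mul_sum, Finset.mul_sum]
  refine Finset.sum_congr rfl fun col _ => ?_
  by_cases h : col 0 = a
  · have h1 := C.framing_succ rot p
    rw [if_pos hp, hp, framing_zero, C.framing_total rot hr] at h1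
    have h2 : C.framing rot p + C.framingJump p = 2 := by linarith
    rw [if_pos h, if_pos h, raisedOut, tailOut, hp, h2, alexander_left_zero, pot_left_zero,
      sub_add_cancel, Pi.sub_apply, Pi.single_eq_same, h,
      show 2 * (rotExponent rot n col - (((n : ℤ) - 1) * 0 - 2 * 0 + 2))
        = -4 + 2 * rotExponent rot n col by ring, LaurentPolynomial.T_add,
      show (n : ℤ) - (a - 1) - 1 = n - a by ring]
    ring
  · rw [if_neg h, if_neg h, mul_zero, mul_zero]

/-- The operator given by the diagram cut at the marked edge is a scalar. -/
theorem stateSum_zero_sub_one {rot : Fin (2 * N) → ℤ} (hr : C.Admissible rot (C.left 0)) {n : ℕ}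
    {a : ℤ} (ha : 1 ≤ a) (han : a < n) :
    C.stateSum rot n 0 (a - 1) = T (-4) * C.stateSum rot n 0 a := by
  set S : (Fin (2 * N) → (Fin (2 * N) → ℤ) → ℤ[T;T⁻¹]) → Fin (2 * N) → ℤ[T;T⁻¹] :=
    fun w p => ∑ col ∈ colorings (2 * N) n, if col 0 = a then w p col else 0 with hS
  have h1 : ∑ p, S (C.raisedIn rot n) p = ∑ p, S (C.raisedOut rot n) p := by
    rw [C.sum_passages, C.sum_passages]
    refine Finset.sum_congr rfl fun x _ => ?_
    simp only [hS, ← Finset.sum_add_distrib]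
    refine Finset.sum_congr rfl fun col hcol => ?_
    by_cases h : col 0 = a
    · simp only [if_pos h]
      exact C.raised_crossing hr n hcol (by omega) x
    · simp only [if_neg h]
  have h2 : ∑ p, (S (C.raisedIn rot n) (p + 1) - S (C.raisedOut rot n) p) = 0 := by
    rw [Finset.sum_sub_distrib, sum_shift, h1, sub_self]
  -- Everything telescopes except at the last passage `-1`, which leads to the marked edge.
  rw [Finset.sum_eq_single (-1)] at h2
  · rw [neg_add_cancel, sub_eq_zero] at h2
    simp only [hS] at h2
    rw [C.sum_raisedIn_zero rot ha han, C.sum_raisedOut_last hr n a (neg_add_cancel 1)] at h2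
    exact mul_left_cancel₀ (qInt_ne_zero (by omega)) h2
  · intro p _ hp
    rw [sub_eq_zero]
    exact C.sum_raisedIn_eq_sum_raisedOut rot n a fun h => hp (eq_neg_of_add_eq_zero_left h)
  · simp

theorem stateSum_zero_eq {rot : Fin (2 * N) → ℤ} (hr : C.Admissible rot (C.left 0)) {n : ℕ}
    (a : ℕ) (han : a < n) :
    C.stateSum rot n 0 a = T (4 * a) * C.stateSum rot n 0 0 := by
  induction a with
  | zero => simp
  | succ a ih =>
    have h1 := ih (by omega)
    have h2 := C.stateSum_zero_sub_one hr (n := n) (a := (a + 1 : ℕ)) (by omega) (by omega)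
    rw [show ((a + 1 : ℕ) : ℤ) - 1 = a by omega, h1] at h2
    have h3 := congrArg (fun z => T 4 * z) h2
    simp only [← mul_assoc, ← LaurentPolynomial.T_add] at h3
    norm_num at h3
    push_cast
    rw [← h3, mul_comm]
    congr 2
    ring

end ClosedDiagram

/-! ### Independence of the edge where the diagram is cut. -/

theorem T_injective {m k : ℤ} (h : (T m : ℤ[T;T⁻¹]) = T k) : m = k :=
  Multiplicative.ofAdd.injective (AddMonoidAlgebra.of_injective (R := ℤ) (M := ℤ)
    (a₁ := Multiplicative.ofAdd m) (a₂ := Multiplicative.ofAdd k) h)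

/-- Up to a unit this is the quantum dimension. For `n ≥ 2` it vanishes at `q = exp (2πi/n)`, so it
has to be cancelled before the evaluation. -/
theorem sum_T_ne_zero {n : ℕ} (hn : n ≠ 0) :
    ∑ a ∈ Finset.range n, (T (4 * (a : ℤ)) : ℤ[T;T⁻¹]) ≠ 0 := by
  intro h
  have h1 : (∑ a ∈ Finset.range n, (T (4 * (a : ℤ)) : ℤ[T;T⁻¹])) * (T 4 - 1)
      = T (4 * (n : ℤ)) - T (4 * ((0 : ℕ) : ℤ)) := by
    rw [← Finset.sum_range_sub (fun a : ℕ => (T (4 * (a : ℤ)) : ℤ[T;T⁻¹])), Finset.sum_mul]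
    refine Finset.sum_congr rfl fun a _ => ?_
    rw [mul_sub, ← LaurentPolynomial.T_add, mul_one]
    push_cast
    ring_nf
  rw [h, zero_mul, eq_comm, sub_eq_zero] at h1
  have := T_injective h1
  omega

namespace ClosedDiagram

variable {N : ℕ} [NeZero (2 * N)] (C : ClosedDiagram N)

/-- The same diagram with another marked edge. -/
def shift (e : Fin (2 * N)) : ClosedDiagram N where
  overP x := C.overP x - e
  underP x := C.underP x - e
  bijective := by
    have : Sum.elim (fun x => C.overP x - e) (fun x => C.underP x - e)
        = (Equiv.subRight e) ∘ Sum.elim C.overP C.underP := by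
      ext z
      rcases z with x | x <;> rfl
    rw [this]
    exact (Equiv.subRight e).bijective.comp C.bijective
  positive := C.positive
  Region := C.Region
  left i := C.left (i + e)
  right i := C.right (i + e)
  west x := by
    have := C.west x
    unfold GaussCode.rising GaussCode.falling at *
    split_ifs at * <;> simp_all [add_right_comm _ (1 : Fin (2 * N)) e]
  south x := by
    have := C.south x
    unfold GaussCode.rising GaussCode.falling at *
    split_ifs at * <;> simp_all
  north x := by
    have := C.north x
    unfold GaussCode.rising GaussCode.falling at *
    split_ifs at * <;> simp_all [add_right_comm _ (1 : Fin (2 * N)) e]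
  east x := by
    have := C.east x
    unfold GaussCode.rising GaussCode.falling at *
    split_ifs at * <;> simp_all [add_right_comm _ (1 : Fin (2 * N)) e]
  cover f := by
    obtain ⟨i, h⟩ := C.cover f
    exact ⟨i - e, by simpa using h⟩
  card_region := C.card_region

theorem shift_rising (e : Fin (2 * N)) (x : Fin N) :
    (C.shift e).rising x = C.rising x - e := by
  unfold GaussCode.rising shift
  simp only
  split_ifs <;> rfl

theorem shift_falling (e : Fin (2 * N)) (x : Fin N) :
    (C.shift e).falling x = C.falling x - e := by
  unfold GaussCode.falling shift
  simp only
  split_ifs <;> rfl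

theorem admissible_shift {rot : Fin (2 * N) → ℤ} {e : Fin (2 * N)}
    (hr : C.Admissible rot (C.left e)) :
    (C.shift e).Admissible (fun i => rot (i + e)) ((C.shift e).left 0) := by
  intro (f : C.Region)
  have h0 : C.left e = C.left (0 + e) := by rw [zero_add]
  have h1 : ∀ φ : Fin (2 * N) → ℤ, ∑ i, φ (i + e) = ∑ i, φ i := fun φ =>
    Equiv.sum_comp (Equiv.addRight e) φ
  have h2 := hr f
  rw [← h1 (fun i => if C.left i = f then rot i else 0),
    ← h1 (fun i => if C.right i = f then rot i else 0), h0] at h2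
  refine Eq.trans ?_ h2
  refine congrArg₂ (· + ·) (congrArg₂ (· + ·) rfl ?_) ?_
  · refine Finset.sum_congr rfl fun x _ => ?_
    rw [shift_falling]
    change (if C.left (C.falling x - e + e) = f then (1 : ℤ) else 0) = _
    rw [sub_add_cancel]
  · refine Finset.sum_congr rfl fun x _ => ?_
    rw [shift_falling]
    change (if C.right (C.falling x - e + 1 + e) = f then (1 : ℤ) else 0) = _
    rw [add_right_comm, sub_add_cancel]

theorem vertexWeight_shift (n : ℕ) (e : Fin (2 * N)) (i o : Fin (2 * N) → ℤ) :
    (C.shift e).vertexWeight n (fun j => i (j + e)) (fun j => o (j + e))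
      = C.vertexWeight n i o := by
  simp only [vertexWeight, shift_rising, shift_falling, sub_add_cancel,
    add_right_comm _ (1 : Fin (2 * N)) e]
  rfl

theorem stateSum_shift (rot : Fin (2 * N) → ℤ) (n : ℕ) (e : Fin (2 * N)) (a : ℤ) :
    (C.shift e).stateSum (fun i => rot (i + e)) n 0 a = C.stateSum rot n e a := by
  symm
  refine Finset.sum_nbij' (fun col i => col (i + e)) (fun col i => col (i - e)) ?_ ?_ ?_ ?_ ?_
  · intro col hc
    rw [mem_colorings] at hc ⊢
    exact fun i => hc _
  · intro col hc
    rw [mem_colorings] at hc ⊢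
    exact fun i => hc _
  · intro col _
    simp
  · intro col _
    simp
  · intro col _
    simp only [vertexWeight_shift, zero_add]
    congr 4
    exact (Equiv.sum_comp (Equiv.addRight e) fun i => rot i * ((n : ℤ) - 1 - 2 * col i)).symm

theorem stateSum_eq {rot : Fin (2 * N) → ℤ} {e : Fin (2 * N)} (hr : C.Admissible rot (C.left e))
    {n : ℕ} {a : ℕ} (ha : a < n) :
    C.stateSum rot n e a = T (4 * a) * C.stateSum rot n e 0 := by
  have h := (C.shift e).stateSum_zero_eq (C.admissible_shift hr) a ha
  rwa [C.stateSum_shift, C.stateSum_shift] at h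

/-- The state sum over all colorings. -/
def closedSum (rot : Fin (2 * N) → ℤ) (n : ℕ) : ℤ[T;T⁻¹] :=
  ∑ col ∈ colorings (2 * N) n, C.vertexWeight n col col * T (2 * rotExponent rot n col)

theorem sum_by_color {M n : ℕ} {A : Type*} [AddCommMonoid A] (e : Fin M)
    (f : (Fin M → ℤ) → A) : ∑ col ∈ colorings M n, f col =
      ∑ a ∈ Finset.range n, ∑ col ∈ colorings M n, if col e = (a : ℤ) then f col else 0 := by
  rw [Finset.sum_comm]
  refine Finset.sum_congr rfl fun col hc => ?_
  have h := (mem_colorings.1 hc e)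
  rw [Finset.sum_eq_single (col e).toNat]
  · rw [if_pos (by omega)]
  · intro b _ hb
    rw [if_neg (by omega)]
  · intro hb
    rw [Finset.mem_range] at hb
    omega

theorem closedSum_eq {rot : Fin (2 * N) → ℤ} {e : Fin (2 * N)}
    (hr : C.Admissible rot (C.left e)) (n : ℕ) :
    C.closedSum rot n
      = (∑ a ∈ Finset.range n, T (4 * (a : ℤ))) * C.stateSum rot n e 0 := by
  rw [closedSum, sum_by_color e, Finset.sum_mul]
  refine Finset.sum_congr rfl fun a ha => ?_
  exact C.stateSum_eq hr (Finset.mem_range.1 ha)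

/-- The rotation numbers after the unbounded region is changed from the left of the edge `e` to its
right. -/
def pushAcross (rot : Fin (2 * N) → ℤ) (e i : Fin (2 * N)) : ℤ := rot i + if i = e then 2 else 0

theorem admissible_pushAcross {rot : Fin (2 * N) → ℤ} {e : Fin (2 * N)} :
    C.Admissible (pushAcross rot e) (C.right e) ↔ C.Admissible rot (C.left e) := by
  have h1 : ∀ (φ : Fin (2 * N) → C.Region) (f : C.Region),
      (∑ i, if φ i = f then pushAcross rot e i else 0)
        = (∑ i, if φ i = f then rot i else 0) + if φ e = f then 2 else 0 := by
    intro φ f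
    have : ∀ i, (if φ i = f then pushAcross rot e i else 0)
        = (if φ i = f then rot i else 0) + if i = e then (if φ e = f then 2 else 0) else 0 := by
      intro i
      by_cases hi : i = e
      · subst hi
        by_cases hf : φ i = f <;> simp [pushAcross, hf]
      · simp [pushAcross, hi]
    simp only [this, Finset.sum_add_distrib, Finset.sum_ite_eq', Finset.mem_univ, if_true]
  unfold Admissible
  refine forall_congr' fun f => ?_
  rw [h1, h1]
  simp only [eq_comm (a := f)]
  split_ifs <;> constructor <;> intro h <;> linarith

/-- The two extra turns multiply the part with color `a` on `e` by `T (4 * (n - 1) - 8 * a)`, which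
turns its factor `T (4 * a)` into `T (4 * (n - 1 - a))`. The reflection of `a` in the quantum
dimension undoes this. -/
theorem closedSum_pushAcross {rot : Fin (2 * N) → ℤ} {e : Fin (2 * N)}
    (hr : C.Admissible rot (C.left e)) (n : ℕ) :
    C.closedSum (pushAcross rot e) n = C.closedSum rot n := by
  have h1 : ∀ col : Fin (2 * N) → ℤ, rotExponent (pushAcross rot e) n col =
      rotExponent rot n col + 2 * ((n : ℤ) - 1 - 2 * col e) := by
    intro col
    simp only [rotExponent, pushAcross, add_mul, Finset.sum_add_distrib]
    simp
  rw [C.closedSum_eq hr, closedSum, sum_by_color e, ← Finset.sum_range_reflect, Finset.sum_mul]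
  refine Finset.sum_congr rfl fun a ha => ?_
  have ha := Finset.mem_range.1 ha
  have h2 : T (8 * (a : ℤ) - 4 * (n - 1)) * C.stateSum rot n e (n - 1 - a : ℕ)
      = T (4 * (a : ℤ)) * C.stateSum rot n e 0 := by
    rw [C.stateSum_eq hr (by omega), ← mul_assoc, ← LaurentPolynomial.T_add]
    congr 2
    omega
  rw [← h2, stateSum, Finset.mul_sum]
  refine Finset.sum_congr rfl fun col _ => ?_
  by_cases h : col e = (n - 1 - a : ℕ)
  · rw [if_pos h, if_pos h, h1, h, mul_left_comm, ← LaurentPolynomial.T_add]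
    congr 2
    omega
  · rw [if_neg h, if_neg h, mul_zero]

/-- The value of the state sum of the diagram cut open does not depend on where it is cut. -/
theorem exists_stateSum_eq {rot₀ : Fin (2 * N) → ℤ} (hr₀ : C.Admissible rot₀ (C.left 0)) {n : ℕ}
    (hn : n ≠ 0) (e : Fin (2 * N)) :
    ∃ rot, C.Admissible rot (C.left e) ∧ C.stateSum rot n e 0 = C.stateSum rot₀ n 0 0 := by
  suffices h : ∃ rot, C.Admissible rot (C.left e) ∧ C.closedSum rot n = C.closedSum rot₀ n by
    obtain ⟨rot, h1, h2⟩ := h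
    refine ⟨rot, h1, ?_⟩
    rw [C.closedSum_eq h1, C.closedSum_eq hr₀] at h2
    exact mul_left_cancel₀ (sum_T_ne_zero hn) h2
  induction e using edge_induction with
  | h0 => exact ⟨rot₀, hr₀, rfl⟩
  | hs p ih =>
    obtain ⟨rot, h1, h2⟩ := ih
    obtain ⟨x, rfl | rfl⟩ := C.exists_rising_or_falling p
    -- Past the rising strand, the unbounded region moves from the west to the north corner, across
    -- the upper left edge.
    · rw [C.west] at h1
      refine ⟨pushAcross rot (C.falling x + 1), ?_, ?_⟩
      · rw [← C.north]
        exact C.admissible_pushAcross.2 h1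
      · rw [C.closedSum_pushAcross h1, h2]
    -- Past the falling strand, it moves from the south to the west corner, across the lower left
    -- edge in the opposite direction.
    · rw [C.south] at h1
      have h3 : pushAcross (fun i => rot i - if i = C.rising x then 2 else 0) (C.rising x) = rot := by
        ext i
        simp [pushAcross]
      rw [← h3] at h1
      refine ⟨_, C.west x ▸ C.admissible_pushAcross.1 h1, ?_⟩
      rw [← C.closedSum_pushAcross (C.admissible_pushAcross.1 h1), h3, h2]

end ClosedDiagram

/-! ### From long knot diagrams to closed diagrams. -/

theorem prod_T {ι : Type*} (s : Finset ι) (f : ι → ℤ) :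
    ∏ i ∈ s, (T (f i) : ℤ[T;T⁻¹]) = T (∑ i ∈ s, f i) := by
  classical
  induction s using Finset.induction_on with
  | empty => simp
  | insert i s hi ih => rw [Finset.prod_insert hi, Finset.sum_insert hi, ih, LaurentPolynomial.T_add]

theorem LongKnotDiagram.localWeight_eq {N : ℕ} (D : LongKnotDiagram N) (n : ℕ) (col : Fin (2 * N + 1) → Fin n) (x : Fin N) :
    D.localWeight n col x = crossingWeight (D.positive x) n ((col (D.sw x) : ℕ) : ℤ)
      ((col (D.se x) : ℕ) : ℤ) ((col (D.nw x) : ℕ) : ℤ) ((col (D.ne x) : ℕ) : ℤ) := by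
  simp only [localWeight, crossingWeight, GaussCode.sw, GaussCode.se, GaussCode.nw, GaussCode.ne,
    GaussCode.rising, GaussCode.falling]
  by_cases h : D.positive x
  · simp only [h, if_true, Int.toNat_natCast]
    split_ifs <;> first | omega | rfl | (congr 1; omega)
  · simp only [h, Bool.false_eq_true, if_false, Int.toNat_natCast]
    split_ifs <;> first | omega | rfl | (congr 1; omega)

section

variable {N : ℕ} [NeZero (2 * N)]

theorem face_castSucc_add_one (G : GaussCode N) (p : Fin (2 * N)) (s : Side) :
    face G ((p + 1).castSucc, s) = face G (p.succ, s) := by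
  rcases val_add_one_cases p with ⟨h, h'⟩ | ⟨h, h'⟩
  · rw [h, show p.succ = Fin.last (2 * N) from Fin.ext h', show (0 : Fin (2 * N)).castSucc = 0 from rfl]
    cases s
    · exact (Quot.sound Corner.outerLeft).symm
    · exact (Quot.sound Corner.outerRight).symm
  · congr 2
    exact Fin.ext h'

namespace LongKnotDiagram

variable (D : LongKnotDiagram N)

/-- A planar diagram has finitely many regions. -/
abbrev fintypeFace : Fintype (Face D.toGaussCode) :=
  have : Finite (Face D.toGaussCode) :=
    Nat.finite_of_card_ne_zero (ne_of_eq_of_ne D.planar (by omega))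
  Fintype.ofFinite _

/-- The diagram of the closure of a long knot. -/
def closure : ClosedDiagram N where
  toGaussCode := D.toGaussCode
  Region := Face D.toGaussCode
  fintypeRegion := D.fintypeFace
  decEqRegion := fun a b => Classical.propDecidable (a = b)
  left i := face D.toGaussCode (i.castSucc, Side.left)
  right i := face D.toGaussCode (i.castSucc, Side.right)
  west x := by
    rw [face_castSucc_add_one]
    exact Quot.sound (Corner.west x)
  south x := Quot.sound (Corner.south x)
  north x := by
    rw [face_castSucc_add_one, face_castSucc_add_one]
    exact Quot.sound (Corner.north x)
  east x := by
    rw [face_castSucc_add_one]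
    exact Quot.sound (Corner.east x)
  cover f := by
    induction f using Quot.inductionOn with
    | h z =>
      obtain ⟨e, s⟩ := z
      induction e using Fin.lastCases with
      | last =>
        refine ⟨0, ?_⟩
        cases s
        · exact Or.inl (Quot.sound Corner.outerLeft)
        · exact Or.inr (Quot.sound Corner.outerRight)
      | cast i =>
        refine ⟨i, ?_⟩
        cases s
        · exact Or.inl rfl
        · exact Or.inr rfl
  card_region := by
    exact (@Nat.card_eq_fintype_card _ D.fintypeFace).symm.trans D.planar

/-- The rotation numbers of the closure of a long knot. -/
def closureRot (i : Fin (2 * N)) : ℤ :=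
  D.rot i.castSucc + if i = 0 then D.rot (Fin.last (2 * N)) - 1 else 0

-- The ends are joined by an arc on the right that makes one clockwise full turn, whence the `-1` in
-- `closureRot`; the left unbounded region becomes the outer one and the right one becomes bounded.
open Classical in
theorem turning_closureRot (f : Face D.toGaussCode) :
    2 * (∑ e : Fin (2 * N), if face D.toGaussCode (e.castSucc, Side.left) = f
        then D.closureRot e else 0)
      - 2 * (∑ e : Fin (2 * N), if face D.toGaussCode (e.castSucc, Side.right) = f
        then D.closureRot e else 0)
      + (∑ x, if face D.toGaussCode (D.se x, Side.left) = f then 1 else 0)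
      + (∑ x, if face D.toGaussCode (D.nw x, Side.right) = f then 1 else 0)
    = turning D.toGaussCode D.rot f - (if face D.toGaussCode (0, Side.left) = f then 2 else 0)
      + if face D.toGaussCode (0, Side.right) = f then 2 else 0 := by
  have h1 : ∀ (φ : Fin (2 * N) → Face D.toGaussCode),
      (∑ i, if φ i = f then D.closureRot i else 0)
        = (∑ i : Fin (2 * N), if φ i = f then D.rot i.castSucc else 0)
          + if φ 0 = f then D.rot (Fin.last (2 * N)) - 1 else 0 := by
    intro φ
    have : ∀ i, (if φ i = f then D.closureRot i else 0)
        = (if φ i = f then D.rot i.castSucc else 0)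
          + if i = 0 then (if φ 0 = f then D.rot (Fin.last (2 * N)) - 1 else 0) else 0 := by
      intro i
      by_cases hi : i = 0
      · subst hi
        by_cases hf : φ 0 = f <;> simp [closureRot, hf]
      · simp [closureRot, hi]
    simp only [this, Finset.sum_add_distrib, Finset.sum_ite_eq', Finset.mem_univ, if_true]
  have h2 : ∀ s, face D.toGaussCode (Fin.last (2 * N), s) = face D.toGaussCode (0, s) := by
    intro s
    cases s
    · exact Quot.sound Corner.outerLeft
    · exact Quot.sound Corner.outerRight
  rw [h1, h1, turning, Fin.sum_univ_castSucc, Fin.sum_univ_castSucc, h2, h2,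
    show (0 : Fin (2 * N)).castSucc = 0 from rfl]
  split_ifs <;> ring

theorem admissible_closureRot : D.closure.Admissible D.closureRot (D.closure.left 0) := by
  intro (f : Face D.toGaussCode)
  have h0 : ∀ x, face D.toGaussCode ((D.falling x + 1).castSucc, Side.right)
      = face D.toGaussCode (D.nw x, Side.right) := fun x => face_castSucc_add_one _ _ _
  have h1 := D.turning_closureRot f
  have h2 : (∑ x, @ite ℤ (face D.toGaussCode ((D.falling x + 1).castSucc, Side.right) = f)
      (Classical.propDecidable _) 1 0)
      = ∑ x, @ite ℤ (face D.toGaussCode (D.nw x, Side.right) = f) (Classical.propDecidable _) 1 0 :=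
    Finset.sum_congr rfl fun x _ => by rw [h0]
  rw [← h2] at h1
  refine h1.trans ?_
  have hne : face D.toGaussCode (0, Side.left) ≠ face D.toGaussCode (0, Side.right) :=
    D.closure.left_ne_right 0
  change _ = 2 - @ite _ (f = face D.toGaussCode (0, Side.left)) (Classical.propDecidable _) 4 0
  by_cases h1 : f = face D.toGaussCode (0, Side.left)
  · rw [h1, D.turning_left, if_pos rfl, if_neg hne.symm, if_pos rfl]
    norm_num
  · by_cases h3 : f = face D.toGaussCode (0, Side.right)
    · rw [h3, D.turning_right, if_neg hne, if_pos rfl, if_neg hne.symm]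
      norm_num
    · rw [D.turning_bounded f h1 h3, if_neg (Ne.symm h1), if_neg (Ne.symm h3), if_neg h1]
      norm_num

/-- The colored Jones polynomial is, up to a unit, the state sum of the closure. -/
theorem coloredJones_eq {n : ℕ} (hn : n ≠ 0) :
    ∃ k : ℤ, D.coloredJones n = T k * D.closure.stateSum D.closureRot n 0 0 := by
  -- The summand `2 * (n - 1)` undoes the turn of the closing arc, which has weight `T (-2 * (n -
  -- 1))` at color `0`.
  refine ⟨D.writhe * ((n : ℤ) ^ 2 - 1) + 2 * (n - 1), ?_⟩
  rw [coloredJones, LaurentPolynomial.T_add, mul_assoc]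
  congr 1
  rw [ClosedDiagram.stateSum, Finset.mul_sum]
  simp only [mul_ite, mul_zero]
  rw [← Finset.sum_filter, ← Finset.sum_filter]
  refine Finset.sum_bij (fun col _ i => ((col i.castSucc : ℕ) : ℤ)) ?_ ?_ ?_ ?_
  · intro col hc
    rw [Finset.mem_filter] at hc ⊢
    rw [mem_colorings]
    refine ⟨fun e => ⟨by positivity, by exact_mod_cast (col e.castSucc).2⟩, ?_⟩
    exact Int.natCast_eq_zero.2 hc.2.1
  · intro c1 h1 c2 h2 h
    rw [Finset.mem_filter] at h1 h2
    ext e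
    induction e using Fin.lastCases with
    | last => rw [h1.2.2, h2.2.2]
    | cast i => exact_mod_cast congrFun h i
  · intro col hc
    rw [Finset.mem_filter, mem_colorings] at hc
    refine ⟨Fin.snoc (α := fun _ => Fin n)
      (fun i => ⟨(col i).toNat, by have := hc.1 i; omega⟩) ⟨0, by omega⟩, ?_, ?_⟩
    · rw [Finset.mem_filter]
      refine ⟨Finset.mem_univ _, ?_, by simp⟩
      rw [show (0 : Fin (2 * N + 1)) = (0 : Fin (2 * N)).castSucc from rfl, Fin.snoc_castSucc]
      simp [hc.2]
    · ext i
      rw [Fin.snoc_castSucc]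
      have := hc.1 i
      simp only
      omega
  · intro col hc
    rw [Finset.mem_filter] at hc
    have hsucc : ∀ p : Fin (2 * N), ((col (p + 1).castSucc : ℕ) : ℤ) = ((col p.succ : ℕ) : ℤ) := by
      intro p
      rcases val_add_one_cases p with ⟨h, h'⟩ | ⟨h, h'⟩
      · rw [h, show p.succ = Fin.last (2 * N) from Fin.ext h',
          show (0 : Fin (2 * N)).castSucc = 0 from rfl, hc.2.1, hc.2.2]
      · congr 3
        exact Fin.ext h'
    have hv : D.closure.vertexWeight n (fun i => ((col i.castSucc : ℕ) : ℤ))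
        (fun i => ((col i.castSucc : ℕ) : ℤ)) = ∏ x, D.localWeight n col x := by
      refine Finset.prod_congr rfl fun x _ => ?_
      rw [localWeight_eq]
      simp only [hsucc]
      rfl
    rw [hv, weight, prod_T, mul_left_comm, ← LaurentPolynomial.T_add]
    congr 2
    rw [Fin.sum_univ_castSucc, hc.2.2]
    simp only [ClosedDiagram.rotExponent, closureRot, add_mul, Finset.sum_add_distrib, ite_mul, zero_mul,
      Finset.sum_ite_eq', Finset.mem_univ, if_true]
    rw [show (0 : Fin (2 * N)).castSucc = 0 from rfl, hc.2.1, ← Finset.mul_sum]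
    push_cast
    ring

end LongKnotDiagram
end

/-! ### Evaluation at the root of unity, and the choice of the cut. -/

theorem ev_T (n : ℕ) (k : ℤ) :
    ev n (T k) = Complex.exp (2 * Real.pi * Complex.I / (4 * n)) ^ k := by
  rw [ev, LaurentPolynomial.eval₂_T]
  simp

theorem norm_ev_T (n : ℕ) (k : ℤ) : ‖ev n (T k)‖ = 1 := by
  have h : (2 * Real.pi * Complex.I / (4 * n) : ℂ)
      = ((2 * Real.pi / (4 * n) : ℝ) : ℂ) * Complex.I := by
    push_cast
    ring
  rw [ev_T, norm_zpow, h, Complex.norm_exp_ofReal_mul_I, one_zpow]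

theorem norm_ev_crossingWeight_self (p : Bool) (n : ℕ) (a b : ℤ) :
    ‖ev n (crossingWeight p n a b b a)‖ = 1 := by
  rw [crossingWeight, if_pos (add_comm a b)]
  cases p
  · simp [Rminus, qBinomial_zero_right, qFalling, norm_ev_T]
  · simp [Rplus, qBinomial_zero_right, qFalling, norm_ev_T]

theorem crossingWeight_ne_zero {p : Bool} {n : ℕ} {a b x y : ℤ}
    (h : crossingWeight p n a b x y ≠ 0) :
    a + b = x + y ∧ (p = true → y ≤ a) ∧ (p = false → x ≤ b) := by
  unfold crossingWeight at h
  cases p <;> simp_all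

namespace ClosedDiagram

variable {N : ℕ} [NeZero (2 * N)] (C : ClosedDiagram N)

/-- The color does not increase along the over-strand and is conserved, at each crossing. -/
def Allowed (col : Fin (2 * N) → ℤ) : Prop :=
  ∀ x, col (C.overP x + 1) ≤ col (C.overP x) ∧
    col (C.overP x + 1) + col (C.underP x + 1) = col (C.overP x) + col (C.underP x)

theorem allowed_of_vertexWeight_ne_zero {n : ℕ} {col : Fin (2 * N) → ℤ}
    (h : C.vertexWeight n col col ≠ 0) : C.Allowed col := by
  intro x
  have h1 := Finset.prod_ne_zero_iff.1 h x (Finset.mem_univ x)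
  obtain ⟨h2, h3, h4⟩ := crossingWeight_ne_zero h1
  simp only [GaussCode.rising, GaussCode.falling] at h2 h3 h4
  cases hp : C.positive x
  · simp only [hp, Bool.false_eq_true, if_false] at h2 h4
    exact ⟨h4 trivial, by linarith⟩
  · simp only [hp, if_true] at h2 h3
    exact ⟨h3 trivial, by linarith⟩

/-- The color does not change along the over-strand of a crossing. -/
def Flat (col : Fin (2 * N) → ℤ) (x : Fin N) : Prop := col (C.overP x + 1) = col (C.overP x)

theorem norm_ev_of_flat (n : ℕ) {col : Fin (2 * N) → ℤ} (h : C.Allowed col) {x : Fin N}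
    (hx : C.Flat col x) :
    ‖ev n (crossingWeight (C.positive x) n (col (C.rising x)) (col (C.falling x))
      (col (C.falling x + 1)) (col (C.rising x + 1)))‖ = 1 := by
  have h1 := (h x).2
  rw [Flat] at hx
  have h2 : col (C.underP x + 1) = col (C.underP x) := by linarith
  have h3 : col (C.rising x + 1) = col (C.rising x) ∧ col (C.falling x + 1) = col (C.falling x) := by
    simp only [GaussCode.rising, GaussCode.falling]
    split_ifs
    · exact ⟨hx, h2⟩
    · exact ⟨h2, hx⟩
  rw [h3.1, h3.2]
  exact norm_ev_crossingWeight_self _ _ _ _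

/-- A triangle inequality over the `n ^ (2 * N)` colorings, in which the crossings `y` and `z`
contribute modulus one. -/
theorem norm_ev_stateSum_le (rot : Fin (2 * N) → ℤ) {n : ℕ} {B : ℝ} (hB : 0 ≤ B)
    (hw : ∀ (p : Bool) (a b x y : ℤ), 0 ≤ a → a < n → 0 ≤ b → b < n → 0 ≤ x → x < n → 0 ≤ y →
      y < n → ‖ev n (crossingWeight p n a b x y)‖ ≤ B)
    {e : Fin (2 * N)} {a : ℤ} {y z : Fin N} (hyz : y ≠ z)
    (hflat : ∀ col ∈ colorings (2 * N) n, C.Allowed col → col e = a →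
      C.Flat col y ∧ C.Flat col z) :
    ‖ev n (C.stateSum rot n e a)‖ ≤ (n : ℝ) ^ (2 * N) * B ^ (N - 2) := by
  classical
  have hterm : ∀ col ∈ colorings (2 * N) n,
      ‖ev n (if col e = a then C.vertexWeight n col col * T (2 * rotExponent rot n col) else 0)‖
        ≤ B ^ (N - 2) := by
    intro col hc
    by_cases he : col e = a
    · rw [if_pos he, map_mul, norm_mul, norm_ev_T, mul_one]
      by_cases hv : C.vertexWeight n col col = 0
      · rw [hv, map_zero, norm_zero]
        positivity
      · have hall := C.allowed_of_vertexWeight_ne_zero hv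
        obtain ⟨fy, fz⟩ := hflat col hc hall he
        rw [mem_colorings] at hc
        rw [vertexWeight, map_prod, norm_prod,
          ← Finset.mul_prod_erase _ _ (Finset.mem_univ y), C.norm_ev_of_flat n hall fy,
          ← Finset.mul_prod_erase _ _ (Finset.mem_erase.2 ⟨hyz.symm, Finset.mem_univ z⟩),
          C.norm_ev_of_flat n hall fz, one_mul, one_mul]
        refine (Finset.prod_le_prod (fun _ _ => norm_nonneg _) fun x _ => hw _ _ _ _ _ (hc _).1
          (hc _).2 (hc _).1 (hc _).2 (hc _).1 (hc _).2 (hc _).1 (hc _).2).trans (le_of_eq ?_)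
        rw [Finset.prod_const,
          Finset.card_erase_of_mem (Finset.mem_erase.2 ⟨hyz.symm, Finset.mem_univ z⟩),
          Finset.card_erase_of_mem (Finset.mem_univ y), Finset.card_univ, Fintype.card_fin]
        rfl
    · rw [if_neg he, map_zero, norm_zero]
      positivity
  rw [stateSum, map_sum]
  refine (norm_sum_le _ _).trans ((Finset.sum_le_card_nsmul _ _ _ hterm).trans ?_)
  rw [nsmul_eq_mul, colorings, Fintype.card_piFinset]
  simp

/-- Otherwise, going round from one under-passage, one would meet only under-passages. -/
theorem exists_under_over (x₀ : Fin N) : ∃ x y, C.underP x + 1 = C.overP y := by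
  by_contra h
  push Not at h
  have key : ∀ i, ∃ x, i + C.underP x₀ = C.underP x := by
    intro i
    induction i using edge_induction with
    | h0 => exact ⟨x₀, zero_add _⟩
    | hs p ih =>
      obtain ⟨x, hx⟩ := ih
      rw [add_right_comm, hx]
      obtain ⟨z, hz⟩ := C.bijective.2 (C.underP x + 1)
      rcases z with y | y
      · exact absurd hz.symm (h x y)
      · exact ⟨y, hz.symm⟩
  obtain ⟨x, hx⟩ := key (C.overP x₀ - C.underP x₀)
  rw [sub_add_cancel] at hx
  have := C.bijective.1 (a₁ := Sum.inl x₀) (a₂ := Sum.inr x) hx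
  simp at this

/-- One can cut the diagram so that two crossings contribute trivially. -/
theorem exists_two_flat (hN : 2 ≤ N) : ∃ (e : Fin (2 * N)) (top : Bool) (y z : Fin N), y ≠ z ∧
    ∀ n : ℕ, ∀ col ∈ colorings (2 * N) n, C.Allowed col →
      col e = (if top then (n : ℤ) - 1 else 0) → C.Flat col y ∧ C.Flat col z := by
  have h1 : (1 : Fin (2 * N)) ≠ 0 := by
    intro h
    have := congrArg Fin.val h
    rw [Fin.val_one', Nat.mod_eq_of_lt (by omega)] at this
    simp at this
  have h2 : (1 + 1 : Fin (2 * N)) ≠ 0 := by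
    intro h
    have := congrArg Fin.val h
    rw [Fin.val_add, Fin.val_one', Nat.mod_eq_of_lt (show 1 < 2 * N by omega),
      Nat.mod_eq_of_lt (by omega)] at this
    simp at this
  obtain ⟨x, y, hxy⟩ := C.exists_under_over ⟨0, by omega⟩
  by_cases hne : x = y
  swap
  -- The color `0` on this edge is reached by a rise at `x` and followed by a fall at `y`, so both
  -- are trivial.
  · refine ⟨C.overP y, false, x, y, hne, fun n col hc hall he => ?_⟩
    rw [mem_colorings] at hc
    simp only [Bool.false_eq_true, if_false] at he
    have a1 := hall x
    have a2 := (hall y).1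
    rw [hxy, he] at a1
    have c1 := (hc (C.underP x)).1
    have c2 := (hc (C.overP y + 1)).1
    refine ⟨?_, ?_⟩
    · rw [Flat]; omega
    · rw [Flat]; omega
  · subst hne
    -- The edge is a kink at `x`; the passage after the kink provides the second crossing.
    obtain ⟨w, hw⟩ := C.bijective.2 (C.overP x + 1)
    rcases w with z | z
    · have hz : C.overP z = C.overP x + 1 := hw
      refine ⟨C.overP x, false, x, z, ?_, fun n col hc hall he => ?_⟩
      · rintro rfl
        exact h1 (left_eq_add.1 hz)
      · rw [mem_colorings] at hc
        simp only [Bool.false_eq_true, if_false] at he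
        have a1 := (hall x).1
        have a2 := (hall z).1
        rw [hz] at a2
        have c1 := (hc (C.overP x + 1)).1
        have c2 := (hc (C.overP x + 1 + 1)).1
        refine ⟨?_, ?_⟩
        · rw [Flat]; omega
        · rw [Flat, hz]; omega
    · have hz : C.underP z = C.overP x + 1 := hw
      refine ⟨C.overP x + 1, true, x, z, ?_, fun n col hc hall he => ?_⟩
      · rintro rfl
        rw [← hxy, add_assoc] at hz
        exact h2 (left_eq_add.1 hz)
      · rw [mem_colorings] at hc
        simp only [if_true] at he
        have a1 := (hall x).1
        have a2 := (hall z)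
        rw [hz] at a2
        have c1 := (hc (C.overP x)).2
        have c2 := (hc (C.overP x + 1 + 1)).2
        refine ⟨?_, ?_⟩
        · rw [Flat]; omega
        · rw [Flat]; omega

end ClosedDiagram

/-- A bound of all crossing weights bounds the colored Jones polynomial at the root of unity. -/
theorem LongKnotDiagram.norm_ev_coloredJones_le {c : ℕ} (D : LongKnotDiagram (c + 2)) {n : ℕ}
    (hn : n ≠ 0) {B : ℝ} (hB : 0 ≤ B)
    (hw : ∀ (p : Bool) (a b x y : ℤ), 0 ≤ a → a < n → 0 ≤ b → b < n → 0 ≤ x → x < n → 0 ≤ y →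
      y < n → ‖ev n (crossingWeight p n a b x y)‖ ≤ B) :
    ‖ev n (D.coloredJones n)‖ ≤ (n : ℝ) ^ (2 * (c + 2)) * B ^ c := by
  have : NeZero (2 * (c + 2)) := ⟨by omega⟩
  obtain ⟨k, hk⟩ := D.coloredJones_eq hn
  obtain ⟨e, top, y, z, hyz, hflat⟩ := D.closure.exists_two_flat (by omega)
  obtain ⟨rot, hr, h0⟩ := D.closure.exists_stateSum_eq D.admissible_closureRot hn e
  have h1 := D.closure.norm_ev_stateSum_le rot hB hw hyz (hflat n)
  rw [hk, map_mul, norm_mul, norm_ev_T, one_mul, ← h0]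
  cases top
  · simpa using h1
  -- The state sums with colors `n - 1` and `0` on the cut edge differ by a unit of modulus one.
  · have h2 := D.closure.stateSum_eq hr (show n - 1 < n by omega)
    have h3 : ‖ev n (D.closure.stateSum rot n e (n - 1 : ℕ))‖
        = ‖ev n (D.closure.stateSum rot n e 0)‖ := by
      rw [h2, map_mul, norm_mul, norm_ev_T, one_mul]
    rw [← h3, show ((n - 1 : ℕ) : ℤ) = (n : ℤ) - 1 by omega]
    simpa using h1

/-! ### The maximum of the growth rate of the weights -/

/-- The integrand of the Lobachevsky function. -/
def logSine (x : ℝ) : ℝ := Real.log |2 * Real.sin x|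

/-- The integral of `log |2 sin x|`, the negative of the Lobachevsky function. -/
def logSineIntegral (x : ℝ) : ℝ := ∫ t in (0 : ℝ)..x, logSine t

theorem logSineIntegral_eq (x : ℝ) : logSineIntegral x = -lobachevsky x := (neg_neg _).symm

theorem logSine_of_mem {x : ℝ} (h0 : 0 < x) (h1 : x < Real.pi) :
    logSine x = Real.log (2 * Real.sin x) := by
  rw [logSine, abs_of_pos (by have := Real.sin_pos_of_pos_of_lt_pi h0 h1; positivity)]

theorem intervalIntegrable_logSine (a b : ℝ) :
    IntervalIntegrable logSine MeasureTheory.volume a b := by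
  have h : MeromorphicOn (fun x : ℝ => 2 * Real.sin x) (Set.uIcc a b) := by
    intro x _
    exact (analyticAt_const.mul Real.analyticAt_sin).meromorphicAt
  have := h.intervalIntegrable_log
  convert this using 1
  ext x
  exact Real.log_abs _

theorem continuous_logSineIntegral : Continuous logSineIntegral :=
  intervalIntegral.continuous_primitive intervalIntegrable_logSine 0

theorem continuousAt_logSine {x : ℝ} (h0 : 0 < x) (h1 : x < Real.pi) : ContinuousAt logSine x := by
  have : 0 < Real.sin x := Real.sin_pos_of_pos_of_lt_pi h0 h1
  refine ContinuousAt.log (by fun_prop) ?_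
  positivity

theorem hasDerivAt_logSineIntegral {x : ℝ} (h0 : 0 < x) (h1 : x < Real.pi) :
    HasDerivAt logSineIntegral (logSine x) x := by
  refine intervalIntegral.integral_hasDerivAt_right (intervalIntegrable_logSine _ _) ?_
    (continuousAt_logSine h0 h1)
  exact ContinuousAt.stronglyMeasurableAtFilter (s := Set.Ioo 0 Real.pi) isOpen_Ioo
    (fun y hy => continuousAt_logSine hy.1 hy.2) x ⟨h0, h1⟩

theorem logSineIntegral_zero : logSineIntegral 0 = 0 := intervalIntegral.integral_same

/-- Euler's integral of `log sin` over `[0, π/2]` is `-(π/2) log 2`, which cancels the contribution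
of the factor `2`. -/
theorem logSineIntegral_pi_div_two : logSineIntegral (Real.pi / 2) = 0 := by
  have h : logSineIntegral (Real.pi / 2)
      = ∫ t in (0 : ℝ)..(Real.pi / 2), (Real.log 2 + Real.log (Real.sin t)) := by
    refine intervalIntegral.integral_congr_ae (Filter.Eventually.of_forall fun t ht => ?_)
    rw [Set.uIoc_of_le (by positivity)] at ht
    have : 0 < Real.sin t := Real.sin_pos_of_pos_of_lt_pi ht.1 (by linarith [ht.2, Real.pi_pos])
    rw [logSine_of_mem ht.1 (by linarith [ht.2, Real.pi_pos]), Real.log_mul two_ne_zero this.ne']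
  rw [h, intervalIntegral.integral_add intervalIntegrable_const
    (by apply intervalIntegrable_log_sin), integral_log_sin_zero_pi_div_two]
  simp
  ring

theorem logSineIntegral_three_pi_div_four :
    logSineIntegral (3 * Real.pi / 4) = -logSineIntegral (Real.pi / 4) := by
  have h1 : ∫ t in (Real.pi / 4)..(Real.pi / 2), logSine (Real.pi - t)
      = ∫ t in (Real.pi / 2)..(3 * Real.pi / 4), logSine t := by
    rw [intervalIntegral.integral_comp_sub_left (fun t => logSine t) Real.pi]
    congr 1 <;> ring
  have h2 : ∀ t, logSine (Real.pi - t) = logSine t := fun t => by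
    rw [logSine, Real.sin_pi_sub, logSine]
  simp only [h2] at h1
  have h3 := intervalIntegral.integral_add_adjacent_intervals
    (intervalIntegrable_logSine 0 (Real.pi / 4)) (intervalIntegrable_logSine (Real.pi / 4) (Real.pi / 2))
  have h4 := intervalIntegral.integral_add_adjacent_intervals
    (intervalIntegrable_logSine 0 (Real.pi / 2))
    (intervalIntegrable_logSine (Real.pi / 2) (3 * Real.pi / 4))
  have h5 := logSineIntegral_pi_div_two
  unfold logSineIntegral at *
  linarith

theorem logSine_le_logSine {x y : ℝ} (hx0 : 0 < x) (hx1 : x < Real.pi) (hy0 : 0 < y)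
    (hy1 : y < Real.pi) (h : Real.sin x ≤ Real.sin y) : logSine x ≤ logSine y := by
  rw [logSine_of_mem hx0 hx1, logSine_of_mem hy0 hy1]
  have := Real.sin_pos_of_pos_of_lt_pi hx0 hx1
  exact Real.log_le_log (by positivity) (by linarith)

/-- Among the intervals of length `k` in `[0, π]`, the integral of `log |2 sin x|` is the largest
over the central one. -/
theorem logSineIntegral_sub_le {b k : ℝ} (hk : 0 ≤ k) (hb : 0 ≤ b) (hbk : b + k ≤ Real.pi) :
    logSineIntegral (b + k) - logSineIntegral b
      ≤ logSineIntegral ((Real.pi + k) / 2) - logSineIntegral ((Real.pi - k) / 2) := by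
  set ψ : ℝ → ℝ := fun b => logSineIntegral (b + k) - logSineIntegral b with hψ
  have hc : Continuous ψ :=
    (continuous_logSineIntegral.comp (continuous_add_const k)).sub continuous_logSineIntegral
  have hd : ∀ x, 0 < x → x + k < Real.pi → HasDerivAt ψ (logSine (x + k) - logSine x) x := by
    intro x h0 h1
    exact ((hasDerivAt_logSineIntegral (by linarith) h1).comp_add_const x k).sub
      (hasDerivAt_logSineIntegral h0 (by linarith))
  -- Thus the derivative of `ψ` has the sign of `cos (x + k / 2)`, which changes at the central
  -- interval.
  have hsin : ∀ x, Real.sin (x + k) - Real.sin x = 2 * Real.sin (k / 2) * Real.cos (x + k / 2) := by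
    intro x
    rw [Real.sin_sub_sin]
    congr 2
    · congr 1; ring
    · ring
  have hk2 : 0 ≤ Real.sin (k / 2) :=
    Real.sin_nonneg_of_nonneg_of_le_pi (by linarith) (by linarith [Real.pi_pos])
  have hmid : logSineIntegral ((Real.pi + k) / 2) - logSineIntegral ((Real.pi - k) / 2)
      = ψ ((Real.pi - k) / 2) := by
    simp only [hψ]
    congr 2
    ring
  rw [hmid]
  change ψ b ≤ _
  rcases le_total b ((Real.pi - k) / 2) with h | h
  · have hm : MonotoneOn ψ (Set.Icc 0 ((Real.pi - k) / 2)) := by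
      refine monotoneOn_of_deriv_nonneg (convex_Icc _ _) hc.continuousOn ?_ ?_
      · intro x hx
        rw [interior_Icc] at hx
        exact (hd x hx.1 (by linarith [hx.2])).differentiableAt.differentiableWithinAt
      · intro x hx
        rw [interior_Icc] at hx
        have h1 : 0 < x := hx.1
        have h2 : x < (Real.pi - k) / 2 := hx.2
        rw [(hd x h1 (by linarith)).deriv, sub_nonneg]
        refine logSine_le_logSine h1 (by linarith) (by linarith) (by linarith) ?_
        have : 0 ≤ Real.cos (x + k / 2) :=
          Real.cos_nonneg_of_neg_pi_div_two_le_of_le (by linarith [Real.pi_pos]) (by linarith)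
        nlinarith [hsin x, mul_nonneg hk2 this]
    exact hm ⟨hb, h⟩ ⟨by linarith, le_rfl⟩ h
  · have hm : AntitoneOn ψ (Set.Icc ((Real.pi - k) / 2) (Real.pi - k)) := by
      refine antitoneOn_of_deriv_nonpos (convex_Icc _ _) hc.continuousOn ?_ ?_
      · intro x hx
        rw [interior_Icc] at hx
        exact (hd x (by linarith [hx.1, hx.2]) (by linarith [hx.2])).differentiableAt.differentiableWithinAt
      · intro x hx
        rw [interior_Icc] at hx
        have h1 : (Real.pi - k) / 2 < x := hx.1
        have h2 : x < Real.pi - k := hx.2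
        rw [(hd x (by linarith) (by linarith)).deriv, sub_nonpos]
        refine logSine_le_logSine (by linarith) (by linarith) (by linarith) (by linarith) ?_
        have : Real.cos (x + k / 2) ≤ 0 :=
          Real.cos_nonpos_of_pi_div_two_le_of_le (by linarith) (by linarith [Real.pi_pos])
        nlinarith [hsin x, mul_nonneg hk2 (neg_nonneg.2 this)]
    exact hm ⟨le_rfl, by linarith⟩ ⟨h, by linarith⟩ h

/-- The derivative of the left side in `k` is `log (cot (k / 2))`, positive before and negative
after `π / 2`; the right side is the value at `π / 2`. -/
theorem two_mul_logSineIntegral_sub_le {k : ℝ} (h0 : 0 ≤ k) (h1 : k ≤ Real.pi) :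
    2 * (logSineIntegral ((Real.pi + k) / 2) - logSineIntegral ((Real.pi - k) / 2))
      - logSineIntegral k ≤ -4 * logSineIntegral (Real.pi / 4) := by
  have hpi := Real.pi_pos
  set φ : ℝ → ℝ := fun k => 2 * (logSineIntegral ((Real.pi + k) / 2)
    - logSineIntegral ((Real.pi - k) / 2)) - logSineIntegral k with hφ
  have hc : Continuous φ := by
    have := continuous_logSineIntegral
    fun_prop
  have hd : ∀ x, 0 < x → x < Real.pi → HasDerivAt φ
      (2 * Real.log (2 * Real.cos (x / 2)) - Real.log (2 * Real.sin x)) x := by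
    intro x h0 h1
    have d1 : HasDerivAt (fun k => logSineIntegral ((Real.pi + k) / 2))
        (logSine ((Real.pi + x) / 2) * (1 / 2)) x := by
      refine HasDerivAt.comp x (hasDerivAt_logSineIntegral (by linarith) (by linarith)) ?_
      exact ((hasDerivAt_id x).const_add Real.pi).div_const 2
    have d2 : HasDerivAt (fun k => logSineIntegral ((Real.pi - k) / 2))
        (logSine ((Real.pi - x) / 2) * (-1 / 2)) x := by
      refine HasDerivAt.comp x (hasDerivAt_logSineIntegral (by linarith) (by linarith)) ?_
      exact ((hasDerivAt_id x).const_sub Real.pi).div_const 2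
    refine (((d1.sub d2).const_mul 2).sub (hasDerivAt_logSineIntegral h0 h1)).congr_deriv ?_
    rw [logSine_of_mem h0 h1, logSine_of_mem (by linarith) (by linarith),
      logSine_of_mem (by linarith) (by linarith),
      show (Real.pi + x) / 2 = x / 2 + Real.pi / 2 by ring,
      show (Real.pi - x) / 2 = Real.pi / 2 - x / 2 by ring, Real.sin_add_pi_div_two,
      Real.sin_pi_div_two_sub]
    ring
  have hcos : ∀ x, 0 < x → x < Real.pi → 0 < Real.cos (x / 2) := fun x h0 h1 =>
    Real.cos_pos_of_mem_Ioo ⟨by linarith, by linarith⟩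
  have hsin : ∀ x, 0 < x → x < Real.pi → 0 < Real.sin (x / 2) := fun x h0 h1 =>
    Real.sin_pos_of_pos_of_lt_pi (by linarith) (by linarith)
  have hdouble : ∀ x, Real.sin x = 2 * Real.sin (x / 2) * Real.cos (x / 2) := fun x => by
    rw [← Real.sin_two_mul]; congr 1; ring
  have hlog : ∀ x, 0 < x → x < Real.pi →
      2 * Real.log (2 * Real.cos (x / 2)) - Real.log (2 * Real.sin x)
        = Real.log (Real.cos (x / 2)) - Real.log (Real.sin (x / 2)) := by
    intro x h0 h1
    have c := (hcos x h0 h1).ne'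
    have s := (hsin x h0 h1).ne'
    rw [hdouble, Real.log_mul two_ne_zero c, Real.log_mul two_ne_zero (by positivity),
      Real.log_mul (by positivity) c, Real.log_mul two_ne_zero s]
    ring
  have hmid : -4 * logSineIntegral (Real.pi / 4) = φ (Real.pi / 2) := by
    simp only [hφ]
    rw [logSineIntegral_pi_div_two, show (Real.pi + Real.pi / 2) / 2 = 3 * Real.pi / 4 by ring,
      show (Real.pi - Real.pi / 2) / 2 = Real.pi / 4 by ring, logSineIntegral_three_pi_div_four]
    ring
  rw [hmid]
  change φ k ≤ _
  have hsc : ∀ x, Real.sin (x / 2) = Real.cos (Real.pi / 2 - x / 2) := fun x =>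
    (Real.cos_pi_div_two_sub _).symm
  rcases le_total k (Real.pi / 2) with h | h
  · have hm : MonotoneOn φ (Set.Icc 0 (Real.pi / 2)) := by
      refine monotoneOn_of_deriv_nonneg (convex_Icc _ _) hc.continuousOn ?_ ?_
      · intro x hx
        rw [interior_Icc] at hx
        exact (hd x hx.1 (by linarith [hx.2])).differentiableAt.differentiableWithinAt
      · intro x hx
        rw [interior_Icc] at hx
        have x0 : 0 < x := hx.1
        have x1 : x < Real.pi / 2 := hx.2
        rw [(hd x x0 (by linarith)).deriv, hlog x x0 (by linarith), sub_nonneg]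
        refine Real.log_le_log (hsin x x0 (by linarith)) ?_
        rw [hsc]
        exact Real.cos_le_cos_of_nonneg_of_le_pi (by linarith) (by linarith) (by linarith)
    exact hm ⟨h0, h⟩ ⟨by linarith, le_rfl⟩ h
  · have hm : AntitoneOn φ (Set.Icc (Real.pi / 2) Real.pi) := by
      refine antitoneOn_of_deriv_nonpos (convex_Icc _ _) hc.continuousOn ?_ ?_
      · intro x hx
        rw [interior_Icc] at hx
        exact (hd x (by linarith [hx.1]) hx.2).differentiableAt.differentiableWithinAt
      · intro x hx
        rw [interior_Icc] at hx
        have x0 : Real.pi / 2 < x := hx.1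
        have x1 : x < Real.pi := hx.2
        rw [(hd x (by linarith) x1).deriv, hlog x (by linarith) x1, sub_nonpos]
        refine Real.log_le_log (hcos x (by linarith) x1) ?_
        rw [hsc]
        exact Real.cos_le_cos_of_nonneg_of_le_pi (by linarith) (by linarith) (by linarith)
    exact hm ⟨le_rfl, by linarith⟩ ⟨h, h1⟩ h

/-- The growth rate of the weights is at most a half of the volume of the octahedron. -/
theorem growth_le {a b k : ℝ} (hk : 0 ≤ k) (hka : k ≤ a) (ha : a ≤ Real.pi) (hb : 0 ≤ b)
    (hbk : b + k ≤ Real.pi) :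
    (logSineIntegral (b + k) - logSineIntegral b) + (logSineIntegral a - logSineIntegral (a - k))
      - logSineIntegral k ≤ v8 / 2 := by
  have h1 := logSineIntegral_sub_le hk hb hbk
  have h2 := logSineIntegral_sub_le (b := a - k) hk (by linarith) (by linarith)
  rw [sub_add_cancel] at h2
  have h3 := two_mul_logSineIntegral_sub_le hk (by linarith)
  rw [logSineIntegral_eq (Real.pi / 4)] at h3
  rw [v8]
  linarith

/-! ### Riemann sums of `log |2 sin x|` -/

theorem logSine_pi_sub (x : ℝ) : logSine (Real.pi - x) = logSine x := by
  rw [logSine, Real.sin_pi_sub, logSine]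

/-- By concavity of the sine, `sin x / x` decreases. -/
theorem logSine_sub_le_log_sub {x y : ℝ} (h0 : 0 < x) (hxy : x ≤ y) (h1 : y < Real.pi) :
    logSine y - logSine x ≤ Real.log y - Real.log x := by
  have hy : 0 < y := h0.trans_le hxy
  have hx1 : 0 ≤ 1 - x / y := sub_nonneg.2 ((div_le_one hy).2 hxy)
  have hx2 : 0 ≤ x / y := by positivity
  have key := strictConcaveOn_sin_Icc.concaveOn.2 (Set.left_mem_Icc.2 Real.pi_pos.le)
    ⟨hy.le, h1.le⟩ hx1 hx2 (sub_add_cancel _ _)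
  simp only [smul_eq_mul, Real.sin_zero, mul_zero, zero_add, div_mul_cancel₀ x hy.ne'] at key
  have sx := Real.sin_pos_of_pos_of_lt_pi h0 (hxy.trans_lt h1)
  have sy := Real.sin_pos_of_pos_of_lt_pi hy h1
  have h2 : Real.log (x / y * Real.sin y) ≤ Real.log (Real.sin x) :=
    Real.log_le_log (by positivity) key
  rw [Real.log_mul (by positivity) sy.ne', Real.log_div h0.ne' hy.ne'] at h2
  rw [logSine_of_mem h0 (hxy.trans_lt h1), logSine_of_mem hy h1,
    Real.log_mul two_ne_zero sx.ne', Real.log_mul two_ne_zero sy.ne']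
  linarith

theorem logSine_sub_le_log_pi_sub {x y : ℝ} (h0 : 0 < x) (hxy : x ≤ y) (h1 : y < Real.pi) :
    logSine x - logSine y ≤ Real.log (Real.pi - x) - Real.log (Real.pi - y) := by
  have := logSine_sub_le_log_sub (x := Real.pi - y) (y := Real.pi - x) (by linarith) (by linarith)
    (by linarith)
  rwa [logSine_pi_sub, logSine_pi_sub] at this

theorem exists_logSineIntegral_sub_eq {x y : ℝ} (h0 : 0 ≤ x) (hxy : x < y) (h1 : y < Real.pi) :
    ∃ t, x < t ∧ t < y ∧ logSineIntegral y - logSineIntegral x = logSine t * (y - x) := by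
  obtain ⟨t, ht, h⟩ := exists_hasDerivAt_eq_slope logSineIntegral logSine hxy
    continuous_logSineIntegral.continuousOn fun t ht =>
      hasDerivAt_logSineIntegral (h0.trans_lt ht.1) (ht.2.trans h1)
  refine ⟨t, ht.1, ht.2, ?_⟩
  rw [h, div_mul_cancel₀ _ (by linarith : y - x ≠ 0)]

/-- On `(0, x)` the integrand is at least `log t + (logSine x - log x)`, and `log t` has the
integral `x (log x - 1)`. -/
theorem le_logSineIntegral {x : ℝ} (h0 : 0 < x) (h1 : x < Real.pi) :
    x * (logSine x - 1) ≤ logSineIntegral x := by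
  have h : ∫ t in (0 : ℝ)..x, (Real.log t + (logSine x - Real.log x)) ≤ ∫ t in (0 : ℝ)..x, logSine t := by
    refine intervalIntegral.integral_mono_on_of_le_Ioo h0.le
      (intervalIntegral.intervalIntegrable_log'.add intervalIntegrable_const)
      (intervalIntegrable_logSine _ _) fun t ht => ?_
    have := logSine_sub_le_log_sub ht.1 ht.2.le h1
    linarith
  rw [intervalIntegral.integral_add intervalIntegral.intervalIntegrable_log'
    intervalIntegrable_const, integral_log, intervalIntegral.integral_const] at h
  rw [logSineIntegral]
  refine le_trans (le_of_eq ?_) h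
  simp only [smul_eq_mul]
  ring

/-- The Riemann sum of `log |2 sin x|` over `m` of the `n` subintervals of `[0, π]`, up to the
factor `π / n`. -/
def logSineSum (n m : ℕ) : ℝ := ∑ j ∈ Finset.range m, logSine (Real.pi * (j + 1) / n)

/-- The error of the Riemann sum `logSineSum`. -/
def sumError (n m : ℕ) : ℝ := logSineSum n m - n / Real.pi * logSineIntegral (Real.pi * m / n)

theorem sumError_zero (n : ℕ) : sumError n 0 = 0 := by
  simp [sumError, logSineSum, logSineIntegral_zero]

/-- By the mean value theorem the new error compares `logSine` at the right end of a subinterval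
with its value at an inner point. -/
theorem exists_sumError_succ_sub {n m : ℕ} (hm : m + 1 < n) :
    ∃ t, (m : ℝ) < t ∧ t < m + 1 ∧ sumError n (m + 1) - sumError n m
      = logSine (Real.pi / n * (m + 1)) - logSine (Real.pi / n * t) := by
  have hpi := Real.pi_pos
  have hn : (0 : ℝ) < n := by exact_mod_cast (by omega : 0 < n)
  have hmn : (m : ℝ) + 1 < n := by exact_mod_cast hm
  obtain ⟨t, h0, h1, h⟩ := exists_logSineIntegral_sub_eq (x := Real.pi * m / n)
    (y := Real.pi * (m + 1 : ℕ) / n) (by positivity)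
    (by push_cast; gcongr; linarith) (by
      push_cast
      rw [div_lt_iff₀ hn]
      exact mul_lt_mul_of_pos_left hmn hpi)
  push_cast at h1 h
  refine ⟨n / Real.pi * t, ?_, ?_, ?_⟩
  · rw [div_lt_iff₀ hn] at h0
    rw [div_mul_eq_mul_div, lt_div_iff₀ hpi]
    linarith
  · rw [lt_div_iff₀ hn] at h1
    rw [div_mul_eq_mul_div, div_lt_iff₀ hpi]
    linarith
  · have e1 : Real.pi / n * (n / Real.pi * t) = t := by field_simp
    rw [e1, sumError, sumError, logSineSum, Finset.sum_range_succ, ← logSineSum]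
    push_cast
    have e2 : n / Real.pi * (logSineIntegral (Real.pi * (m + 1) / n)
        - logSineIntegral (Real.pi * m / n)) = logSine t := by
      rw [h]
      field_simp
      ring
    rw [show Real.pi * ((m : ℝ) + 1) / n = Real.pi / n * (m + 1) by ring] at *
    linarith

theorem sumError_succ_sub_le {n m : ℕ} (h0 : m ≠ 0) (hm : m + 1 < n) :
    sumError n (m + 1) - sumError n m ≤ Real.log (m + 1 : ℕ) - Real.log m := by
  have hpi := Real.pi_pos
  have hn : (0 : ℝ) < n := by exact_mod_cast (by omega : 0 < n)
  have hm0 : (0 : ℝ) < m := by exact_mod_cast (by omega : 0 < m)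
  have hmn : (m : ℝ) + 1 < n := by exact_mod_cast hm
  obtain ⟨t, h1, h2, h⟩ := exists_sumError_succ_sub hm
  have ht : 0 < t := hm0.trans h1
  rw [h]
  have h3 := logSine_sub_le_log_sub (x := Real.pi / n * t) (y := Real.pi / n * (m + 1))
    (by positivity) (by gcongr) (by
      rw [div_mul_eq_mul_div, div_lt_iff₀ hn]
      exact mul_lt_mul_of_pos_left hmn hpi)
  rw [Real.log_mul (by positivity) (by positivity), Real.log_mul (by positivity) ht.ne'] at h3
  have h4 := Real.log_le_log hm0 h1.le
  push_cast
  linarith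

theorem sumError_sub_succ_le {n m : ℕ} (hm : m + 1 < n) :
    sumError n m - sumError n (m + 1)
      ≤ Real.log ((n : ℝ) - m) - Real.log ((n : ℝ) - (m + 1 : ℕ)) := by
  have hpi := Real.pi_pos
  have hn : (0 : ℝ) < n := by exact_mod_cast (by omega : 0 < n)
  have hm0 : (0 : ℝ) ≤ m := m.cast_nonneg
  have hmn : (m : ℝ) + 1 < n := by exact_mod_cast hm
  obtain ⟨t, h1, h2, h⟩ := exists_sumError_succ_sub hm
  have ht : 0 < t := hm0.trans_lt h1
  have h3 := logSine_sub_le_log_pi_sub (x := Real.pi / n * t) (y := Real.pi / n * (m + 1))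
    (by positivity) (by gcongr) (by
      rw [div_mul_eq_mul_div, div_lt_iff₀ hn]
      exact mul_lt_mul_of_pos_left hmn hpi)
  have e : ∀ s : ℝ, Real.pi - Real.pi / n * s = Real.pi / n * (n - s) := fun s => by field_simp
  rw [e, e, Real.log_mul (by positivity) (by linarith), Real.log_mul (by positivity) (by linarith)]
    at h3
  have h4 : Real.log ((n : ℝ) - t) ≤ Real.log (n - m) := Real.log_le_log (by linarith) (by linarith)
  push_cast
  linarith

/-- The first subinterval contains the singularity at `0`, where the bound by `log (m + 1) - log m`
is not available. -/
theorem sumError_one_le {n : ℕ} (hn : 1 < n) : sumError n 1 ≤ 1 := by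
  have hpi := Real.pi_pos
  have hn1 : (1 : ℝ) < n := by exact_mod_cast hn
  have hn0 : (0 : ℝ) < n := by linarith
  have h := le_logSineIntegral (x := Real.pi / n) (by positivity) (div_lt_self hpi hn1)
  have h2 := mul_le_mul_of_nonneg_left h (show 0 ≤ n / Real.pi by positivity)
  have e : n / Real.pi * (Real.pi / n * (logSine (Real.pi / n) - 1))
      = logSine (Real.pi / n) - 1 := by
    field_simp
  rw [e] at h2
  simp only [sumError, logSineSum, Finset.sum_range_one, Nat.cast_zero, zero_add, Nat.cast_one,
    mul_one]
  linarith

theorem sumError_sub_le_log {n a m : ℕ} (ha : a ≠ 0) (ham : a ≤ m) (hm : m < n) :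
    sumError n m - sumError n a ≤ Real.log m - Real.log a := by
  induction m, ham using Nat.le_induction with
  | base => simp
  | succ m ham ih =>
    have := sumError_succ_sub_le (show m ≠ 0 by omega) hm
    linarith [ih (by omega)]

theorem sumError_sub_le {n a m : ℕ} (ham : a ≤ m) (hm : m < n) :
    sumError n m - sumError n a ≤ Real.log n + 1 := by
  rcases Nat.eq_zero_or_pos m with rfl | hm0
  · obtain rfl : a = 0 := by omega
    have := Real.log_natCast_nonneg n
    linarith
  have hmn : Real.log m ≤ Real.log n :=
    Real.log_le_log (by exact_mod_cast hm0) (by exact_mod_cast hm.le)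
  rcases Nat.eq_zero_or_pos a with rfl | ha
  · have h1 := sumError_sub_le_log one_ne_zero hm0 hm
    have h2 := sumError_one_le (show 1 < n by omega)
    rw [sumError_zero]
    simp at h1
    linarith
  · have h1 := sumError_sub_le_log ha.ne' ham hm
    have := Real.log_natCast_nonneg a
    linarith

/-- The bounds reflected at `π` telescope to `log n - log (n - m)`, and `n - m ≥ 1`. -/
theorem neg_sumError_le {n m : ℕ} (hm : m < n) : -sumError n m ≤ Real.log n := by
  have h : -sumError n m ≤ Real.log n - Real.log ((n : ℝ) - m) := by
    induction m with
    | zero => simp [sumError_zero]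
    | succ m ih => linarith [ih (by omega), sumError_sub_succ_le hm]
  have h1 : (1 : ℝ) ≤ n - m := by
    have : (m : ℝ) + 1 ≤ n := by exact_mod_cast hm
    linarith
  linarith [Real.log_nonneg h1]

/-- The logarithm of the modulus of a nonzero entry of the braiding, at the root of unity. -/
theorem logSineSum_le {n a b k : ℕ} (hka : k ≤ a) (ha : a < n) (hbk : b + k < n) :
    logSineSum n (b + k) + logSineSum n a
        - (logSineSum n k + logSineSum n b + logSineSum n (a - k))
      ≤ n * v8 / (2 * Real.pi) + 3 * Real.log n + 2 := by
  have hpi := Real.pi_pos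
  have hn : (0 : ℝ) < n := by exact_mod_cast (by omega : 0 < n)
  -- The three errors cost `log n + 1`, `log n + 1` and `log n`.
  have h1 := sumError_sub_le (Nat.le_add_right b k) hbk
  have h2 := sumError_sub_le (Nat.sub_le a k) ha
  have h3 := neg_sumError_le (hka.trans_lt ha)
  have hle : ∀ {m : ℕ}, m < n → Real.pi * m / n ≤ Real.pi := fun {m} hm => by
    rw [div_le_iff₀ hn]
    exact mul_le_mul_of_nonneg_left (by exact_mod_cast hm.le) hpi.le
  have h4 := growth_le (a := Real.pi * a / n) (b := Real.pi * b / n) (k := Real.pi * k / n)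
    (by positivity) (by gcongr) (hle ha) (by positivity)
    (by rw [← add_div, ← mul_add]; exact_mod_cast hle hbk)
  rw [← add_div, ← mul_add, ← sub_div, ← mul_sub, ← Nat.cast_add, ← Nat.cast_sub hka] at h4
  have h5 := mul_le_mul_of_nonneg_left h4 (show 0 ≤ n / Real.pi by positivity)
  rw [show n / Real.pi * (v8 / 2) = n * v8 / (2 * Real.pi) by field_simp] at h5
  simp only [sumError] at h1 h2 h3
  linarith

/-! ### The moduli of the weights at the root of unity -/

theorem norm_ev_qInt (n : ℕ) (m : ℤ) : ‖ev n (qInt m)‖ = |2 * Real.sin (Real.pi * m / n)| := by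
  have e : ∀ k : ℤ, ev n (T (2 * k)) = Complex.exp (((Real.pi * k / n : ℝ) : ℂ) * Complex.I) := by
    intro k
    rw [ev_T, ← Complex.exp_int_mul]
    congr 1
    push_cast
    by_cases hn : (n : ℂ) = 0
    · simp [hn]
    · field_simp
      ring
  rw [qInt, map_sub, ← mul_neg, e, e, ← Real.norm_eq_abs, ← Complex.norm_real]
  push_cast
  rw [Complex.two_sin, norm_mul, Complex.norm_I, mul_one, norm_sub_rev]
  congr 3
  ring_nf

theorem norm_ev_qInt_sub {n : ℕ} (hn : n ≠ 0) (m : ℤ) :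
    ‖ev n (qInt (n - m))‖ = ‖ev n (qInt m)‖ := by
  have : (n : ℝ) ≠ 0 := by exact_mod_cast hn
  rw [norm_ev_qInt, norm_ev_qInt, show Real.pi * (((n : ℤ) - m : ℤ) : ℝ) / n
    = Real.pi - Real.pi * m / n by push_cast; field_simp, Real.sin_pi_sub]

theorem norm_ev_qInt_eq_exp {n m : ℕ} (hm : m + 1 < n) :
    ‖ev n (qInt (m + 1))‖ = Real.exp (logSine (Real.pi * (m + 1) / n)) := by
  have hn : (0 : ℝ) < n := by exact_mod_cast (by omega : 0 < n)
  have hs : 0 < Real.sin (Real.pi * (m + 1) / n) := by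
    refine Real.sin_pos_of_pos_of_lt_pi (by positivity) ?_
    rw [div_lt_iff₀ hn]
    exact mul_lt_mul_of_pos_left (by exact_mod_cast hm) Real.pi_pos
  rw [norm_ev_qInt, logSine, Real.exp_log (by positivity)]
  push_cast
  rfl

theorem norm_ev_qFactorial {n m : ℕ} (hm : m < n) :
    ‖ev n (qFactorial m)‖ = Real.exp (logSineSum n m) := by
  rw [qFactorial, map_prod, norm_prod, logSineSum, Real.exp_sum]
  refine Finset.prod_congr rfl fun i hi => norm_ev_qInt_eq_exp ?_
  have := Finset.mem_range.1 hi
  omega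

/-- The reflection `|{n - m}| = |{m}|` turns the falling product into `{a}! / {a - k}!`. -/
theorem norm_ev_qFalling_mul {n a k : ℕ} (hka : k ≤ a) (ha : a < n) :
    ‖ev n (qFalling ((n : ℤ) - 1 + k - a) k)‖ * Real.exp (logSineSum n (a - k))
      = Real.exp (logSineSum n a) := by
  obtain ⟨j, rfl⟩ := Nat.exists_eq_add_of_le hka
  rw [Nat.add_sub_cancel_left, ← norm_ev_qFactorial ha,
    ← norm_ev_qFactorial (show j < n by omega), add_comm k j, qFactorial, qFactorial,
    Finset.prod_range_add, map_mul, norm_mul, mul_comm, qFalling, map_prod, map_prod, map_prod,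
    norm_prod, norm_prod, norm_prod]
  congr 1
  refine Finset.prod_congr rfl fun i _ => ?_
  rw [← norm_ev_qInt_sub (by omega)]
  congr 3
  push_cast
  ring

theorem norm_ev_qBinomial_mul {n b k : ℕ} (hbk : b + k < n) :
    ‖ev n (qBinomial (b + k) k)‖ * (Real.exp (logSineSum n k) * Real.exp (logSineSum n b))
      = Real.exp (logSineSum n (b + k)) := by
  rw [← norm_ev_qFactorial hbk, ← norm_ev_qFactorial (show k < n by omega),
    ← norm_ev_qFactorial (show b < n by omega), ← norm_mul, ← norm_mul, ← map_mul, ← map_mul,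
    qBinomial_mul]

theorem norm_ev_braiding_le {n a b k : ℕ} (hka : k ≤ a) (ha : a < n) (hbk : b + k < n) :
    ‖ev n (qBinomial (b + k) k)‖ * ‖ev n (qFalling ((n : ℤ) - 1 + k - a) k)‖
      ≤ Real.exp (n * v8 / (2 * Real.pi) + 3 * Real.log n + 2) := by
  refine le_trans (le_of_eq ?_) (Real.exp_le_exp.2 (logSineSum_le hka ha hbk))
  rw [Real.exp_sub, Real.exp_add, Real.exp_add, Real.exp_add, ← norm_ev_qFalling_mul hka ha,
    ← norm_ev_qBinomial_mul hbk]
  have := Real.exp_pos (logSineSum n k)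
  have := Real.exp_pos (logSineSum n b)
  have := Real.exp_pos (logSineSum n (a - k))
  field_simp

theorem norm_ev_crossingWeight_le (p : Bool) (n : ℕ) (a b x y : ℤ) (ha0 : 0 ≤ a) (ha : a < n)
    (hb0 : 0 ≤ b) (hb : b < n) (hx0 : 0 ≤ x) (hx : x < n) (hy0 : 0 ≤ y) (hy : y < n) :
    ‖ev n (crossingWeight p n a b x y)‖
      ≤ Real.exp (n * v8 / (2 * Real.pi) + 3 * Real.log n + 2) := by
  have hpos := (Real.exp_pos (n * v8 / (2 * Real.pi) + 3 * Real.log n + 2)).le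
  unfold crossingWeight
  split_ifs with h1 h2 h3 h4
  · have := norm_ev_braiding_le (n := n) (a := a.toNat) (b := b.toNat) (k := (a - y).toNat)
      (by omega) (by omega) (by omega)
    simpa only [Rplus, map_mul, map_pow, map_neg, map_one, norm_mul, norm_pow, norm_neg, norm_one,
      one_pow, one_mul, norm_ev_T] using this
  · simpa using hpos
  · have := norm_ev_braiding_le (n := n) (a := b.toNat) (b := a.toNat) (k := (b - x).toNat)
      (by omega) (by omega) (by omega)
    simpa only [Rminus, map_mul, norm_mul, norm_ev_T, one_mul] using this
  · simpa using hpos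
  · simpa using hpos

/-- The exponential growth rate of the colored Jones polynomial, with an explicit error term. -/
theorem LongKnotDiagram.log_enorm_ev_coloredJones_le {c : ℕ} (D : LongKnotDiagram (c + 2)) {n : ℕ}
    (hn : n ≠ 0) : ENNReal.log ‖ev n (D.coloredJones n)‖ₑ / (n : EReal)
      ≤ ((c * v8 / (2 * Real.pi) + (5 * c + 4) * (Real.log n / n) + 2 * c / n : ℝ) : EReal) := by
  have hn0 : (0 : ℝ) < n := by exact_mod_cast Nat.pos_of_ne_zero hn
  have h := D.norm_ev_coloredJones_le hn (Real.exp_pos _).le (norm_ev_crossingWeight_le · n)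
  have hpos : 0 < (n : ℝ) ^ (2 * (c + 2))
      * Real.exp (n * v8 / (2 * Real.pi) + 3 * Real.log n + 2) ^ c := by positivity
  have h1 : ENNReal.log ‖ev n (D.coloredJones n)‖ₑ
      ≤ ((Real.log ((n : ℝ) ^ (2 * (c + 2))
        * Real.exp (n * v8 / (2 * Real.pi) + 3 * Real.log n + 2) ^ c) : ℝ) : EReal) := by
    rw [← ENNReal.log_ofReal_of_pos hpos, ← ofReal_norm]
    exact ENNReal.log_le_log (ENNReal.ofReal_le_ofReal h)
  -- The coefficient `5 * c + 4` of `log n` is `2 * (c + 2)` from the number of colorings plus `3 *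
  -- c` from the weights.
  refine (EReal.div_le_div_right_of_nonneg (by positivity) h1).trans (le_of_eq ?_)
  rw [← EReal.coe_natCast, ← EReal.coe_div, Real.log_mul (by positivity) (by positivity),
    Real.log_pow, Real.log_pow, Real.log_exp]
  congr 1
  push_cast
  field_simp
  ring

end ColoredJones

end

/-! ### Passage to the limit. -/

theorem theorem4 (c : ℕ) (D : ColoredJones.LongKnotDiagram (c + 2)) :
    ((2 * Real.pi : ℝ) : EReal) *
        Filter.limsup
          (fun n : ℕ => ENNReal.log ‖ColoredJones.ev n (D.coloredJones n)‖ₑ / (n : EReal))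
          Filter.atTop
      ≤ ((ColoredJones.v8 * (c : ℝ) : ℝ) : EReal) := by
  have h0 : Filter.Tendsto (fun n : ℕ => Real.log n / n) Filter.atTop (nhds 0) :=
    Real.isLittleO_log_id_atTop.tendsto_div_nhds_zero.comp tendsto_natCast_atTop_atTop
  have h1 : Filter.Tendsto (fun n : ℕ => c * ColoredJones.v8 / (2 * Real.pi)
      + (5 * c + 4) * (Real.log n / n) + 2 * c / n) Filter.atTop
      (nhds (c * ColoredJones.v8 / (2 * Real.pi))) := by
    simpa using ((h0.const_mul (5 * (c : ℝ) + 4)).const_add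
      (c * ColoredJones.v8 / (2 * Real.pi))).add (tendsto_const_div_atTop_nhds_zero_nat (2 * (c : ℝ)))
  have h2 := (Filter.limsup_le_limsup ((Filter.eventually_ne_atTop 0).mono fun n hn =>
    D.log_enorm_ev_coloredJones_le hn)).trans_eq (EReal.tendsto_coe.2 h1).limsup_eq
  have h3 : (0 : EReal) ≤ ((2 * Real.pi : ℝ) : EReal) := by
    exact_mod_cast (by positivity : (0 : ℝ) ≤ 2 * Real.pi)
  refine (mul_le_mul_of_nonneg_left h2 h3).trans (le_of_eq ?_)
  rw [← EReal.coe_mul]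
  congr 1
  field_simp
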